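/- Let $N\ge 3$ and let $\Omega\subset\mathbb R^N$ be a bounded open set with $0\in\partial\Omega$ whose boundary is of class $C^{1,1}$ near $0$: there are $r_0\in(0,1)$ and $g\in C^{1,1}(\mathbb R^{N-1})$ such that $B_{r_0}\cap\Omega=\{x\in B_{r_0}: x_N>g(x')\}$ and $B_{r_0}\cap\partial\Omega=\{x\in B_{r_0}: x_N=g(x')\}$, where $B_{r_0}$ is the open ball of radius $r_0$ centred at $0$ and $x'=(x_1,\dots,x_{N-1})$. Let $\mathcal V\subset\mathbb R^N$ be a bounded open set with $0\in\mathcal V$ and $\operatorname{diam}\mathcal V<r_0$, and for $\varepsilon\in(0,1)$ put $\Sigma_\varepsilon=(\varepsilon\mathcal V)\cap\partial\Omega$. Let $H^1_{0,\partial\Omega\setminus\Sigma_\varepsilon}(\Omega)$ be the closure in $H^1(\Omega)$ of $C_c^\infty(\overline\Omega\setminus(\partial\Omega\setminus\Sigma_\varepsilon))$, i.e. of the restrictions to $\Omega$ of the smooth functions with compact support in $\mathbb R^N\setminus(\partial\Omega\setminus\Sigma_\varepsilon)$. For a closed subspace $V\subseteq H^1(\Omega)$ (all functions real-valued), an eigenfunction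 on $V$ with eigenvalue $\lambda\in\mathbb R$ is a $\varphi\in V$, $\varphi\not\equiv0$, with $\int_\Omega\nabla\varphi\cdot\nabla v\,dx=\lambda\int_\Omega\varphi v\,dx$ for all $v\in V$. Let $\lambda_1\le\lambda_2\le\cdots$ be the eigenvalues on $V=H^1_0(\Omega)$ (Dirichlet problem), and $\lambda_1^\varepsilon\le\lambda_2^\varepsilon\le\cdots$ those on $V=H^1_{0,\partial\Omega\setminus\Sigma_\varepsilon}(\Omega)$ (Neumann condition on $\Sigma_\varepsilon$, Dirichlet condition on $\partial\Omega\setminus\Sigma_\varepsilon$), in both cases repeated according to multiplicity. Let $i\ge1$ be such that $\lambda_i$ is simple, and let $\varphi_i$ be an associated eigenfunction on $H^1_0(\Omega)$ with $\int_\Omega\varphi_i^2\,dx=1$. For every $\varepsilon\in(0,1)$ let $\varphi_i^\varepsilon$ be an eigenfunction on $H^1_{0,\partial\Omega\setminus\Sigma_\varepsilon}(\Omega)$ with eigenvalue $\lambda_i^\varepsilon$ such that $\int_\Omega(\varphi_i^\varepsilon)^2\,dx=1$ and $\int_\Omega\varphi_i^\varepsilon\varphi_i\,dx\ge0$. Then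 $\varphi_i^\varepsilon\to\varphi_i$ strongly in $H^1(\Omega)$ as $\varepsilon\to0^+$. -/

import Mathlib

open MeasureTheory Filter Topology Set
open scoped ContDiff Pointwise

noncomputable section

namespace MixedEigen

/-- The space `ℝ^N` with `N = n + 1`. -/
abbrev Sp (n : ℕ) : Type := EuclideanSpace ℝ (Fin (n + 1))

/-- The first `N - 1` coordinates `x' = (x_1, …, x_{N-1})`. -/
def firstCoords {n : ℕ} (x : Sp n) : EuclideanSpace ℝ (Fin n) :=
  WithLp.toLp 2 (fun j => x j.castSucc)

/-- The last coordinate `x_N`. -/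
def lastCoord {n : ℕ} (x : Sp n) : ℝ := x (Fin.last n)

/-- Inside the ball `B_r` around the origin, `Ω` is the strict epigraph, and `∂Ω` the graph, of a
`C^{1,1}` function of the first `N - 1` variables. -/
def IsC11NearOrigin {n : ℕ} (Ω : Set (Sp n)) (r : ℝ) : Prop :=
  ∃ g : EuclideanSpace ℝ (Fin n) → ℝ,
    ContDiff ℝ 1 g ∧ (∃ K, LipschitzWith K (fderiv ℝ g)) ∧
    Metric.ball 0 r ∩ Ω = {x | x ∈ Metric.ball 0 r ∧ g (firstCoords x) < lastCoord x} ∧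
    Metric.ball 0 r ∩ frontier Ω = {x | x ∈ Metric.ball 0 r ∧ lastCoord x = g (firstCoords x)}

/-- `ψ ∈ C_c^∞(U)`, as a function on the whole space. -/
def IsTest {n : ℕ} (U : Set (Sp n)) (ψ : Sp n → ℝ) : Prop :=
  ContDiff ℝ ∞ ψ ∧ HasCompactSupport ψ ∧ tsupport ψ ⊆ U

/-- `L²(Ω)`. -/
abbrev L2s {n : ℕ} (Ω : Set (Sp n)) : Type := Lp ℝ 2 (volume.restrict Ω)

/-- `L²(Ω; ℝ^N)`. -/
abbrev L2v {n : ℕ} (Ω : Set (Sp n)) : Type := Lp (Sp n) 2 (volume.restrict Ω)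

/-- `G` is the weak gradient of `u` in `Ω`. -/
def IsWeakGradient {n : ℕ} (Ω : Set (Sp n)) (u : Sp n → ℝ) (G : Sp n → Sp n) : Prop :=
  ∀ ψ : Sp n → ℝ, IsTest Ω ψ → ∀ v : Sp n,
    ∫ x in Ω, u x * fderiv ℝ ψ x v = - ∫ x in Ω, inner ℝ (G x) v * ψ x

lemma IsTest.integrable_mul_fderiv {n : ℕ} {Ω : Set (Sp n)} {U : Set (Sp n)} {ψ : Sp n → ℝ}
    (h : IsTest U ψ) (u : L2s Ω) (v : Sp n) :
    Integrable (fun x => u x * fderiv ℝ ψ x v) (volume.restrict Ω) := by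
  have hc : Continuous (fun x => fderiv ℝ ψ x v) :=
    (h.1.continuous_fderiv (by simp)).clm_apply continuous_const
  have hs : HasCompactSupport (fun x => fderiv ℝ ψ x v) := h.2.1.fderiv_apply (𝕜 := ℝ) v
  exact (Lp.memLp u).integrable_mul (q := 2) ((hc.memLp_of_hasCompactSupport hs).restrict Ω)

lemma IsTest.integrable_inner_mul {n : ℕ} {Ω : Set (Sp n)} {U : Set (Sp n)} {ψ : Sp n → ℝ}
    (h : IsTest U ψ) (G : L2v Ω) (v : Sp n) :
    Integrable (fun x => inner ℝ (G x) v * ψ x) (volume.restrict Ω) := by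
  exact ((Lp.memLp G).inner_const v).integrable_mul (q := 2)
    ((h.1.continuous.memLp_of_hasCompactSupport h.2.1).restrict Ω)

/-- The Sobolev space `H¹(Ω)`, realized as the space of pairs `(u, ∇u)` in `L²(Ω) × L²(Ω; ℝ^N)`
with `∇u` the weak gradient of `u`.  Its norm is `(‖u‖² + ‖∇u‖²)^{1/2}` with `L²(Ω)` norms. -/
def H1 {n : ℕ} (Ω : Set (Sp n)) : Submodule ℝ (WithLp 2 (L2s Ω × L2v Ω)) where
  carrier := {w | IsWeakGradient Ω w.fst w.snd}
  zero_mem' := by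
    intro ψ hψ v
    have h1 : (fun x => ((0 : L2s Ω) : Sp n → ℝ) x * fderiv ℝ ψ x v)
        =ᵐ[volume.restrict Ω] fun _ => 0 := by
      filter_upwards [Lp.coeFn_zero ℝ 2 (volume.restrict Ω)] with x hx
      rw [hx, Pi.zero_apply, zero_mul]
    have h2 : (fun x => inner ℝ (((0 : L2v Ω) : Sp n → Sp n) x) v * ψ x)
        =ᵐ[volume.restrict Ω] fun _ => 0 := by
      filter_upwards [Lp.coeFn_zero (Sp n) 2 (volume.restrict Ω)] with x hx
      rw [hx, Pi.zero_apply, inner_zero_left, zero_mul]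
    simp only [WithLp.zero_fst, WithLp.zero_snd]
    rw [integral_congr_ae h1, integral_congr_ae h2]
    simp
  add_mem' := by
    intro a b ha hb ψ hψ v
    have h1 : (fun x => ((a.fst + b.fst : L2s Ω) : Sp n → ℝ) x * fderiv ℝ ψ x v)
        =ᵐ[volume.restrict Ω]
          fun x => a.fst x * fderiv ℝ ψ x v + b.fst x * fderiv ℝ ψ x v := by
      filter_upwards [Lp.coeFn_add a.fst b.fst] with x hx
      rw [hx, Pi.add_apply, add_mul]
    have h2 : (fun x => inner ℝ (((a.snd + b.snd : L2v Ω) : Sp n → Sp n) x) v * ψ x)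
        =ᵐ[volume.restrict Ω]
          fun x => inner ℝ (a.snd x) v * ψ x + inner ℝ (b.snd x) v * ψ x := by
      filter_upwards [Lp.coeFn_add a.snd b.snd] with x hx
      rw [hx, Pi.add_apply, inner_add_left, add_mul]
    simp only [WithLp.add_fst, WithLp.add_snd]
    rw [integral_congr_ae h1, integral_congr_ae h2,
      integral_add (hψ.integrable_mul_fderiv _ v) (hψ.integrable_mul_fderiv _ v),
      integral_add (hψ.integrable_inner_mul _ v) (hψ.integrable_inner_mul _ v),
      ha ψ hψ v, hb ψ hψ v]
    ring
  smul_mem' := by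
    intro c a ha ψ hψ v
    have h1 : (fun x => ((c • a.fst : L2s Ω) : Sp n → ℝ) x * fderiv ℝ ψ x v)
        =ᵐ[volume.restrict Ω] fun x => c * (a.fst x * fderiv ℝ ψ x v) := by
      filter_upwards [Lp.coeFn_smul c a.fst] with x hx
      rw [hx, Pi.smul_apply, smul_eq_mul, mul_assoc]
    have h2 : (fun x => inner ℝ (((c • a.snd : L2v Ω) : Sp n → Sp n) x) v * ψ x)
        =ᵐ[volume.restrict Ω] fun x => c * (inner ℝ (a.snd x) v * ψ x) := by
      filter_upwards [Lp.coeFn_smul c a.snd] with x hx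
      rw [hx, Pi.smul_apply, real_inner_smul_left, mul_assoc]
    simp only [WithLp.smul_fst, WithLp.smul_snd]
    rw [integral_congr_ae h1, integral_congr_ae h2, integral_const_mul, integral_const_mul,
      ha ψ hψ v]
    ring

/-- The underlying `L²` function of an element of `H¹(Ω)`. -/
def val {n : ℕ} {Ω : Set (Sp n)} (w : H1 Ω) : L2s Ω := (w : WithLp 2 (L2s Ω × L2v Ω)).fst

/-- The weak gradient of an element of `H¹(Ω)`. -/
def grad {n : ℕ} {Ω : Set (Sp n)} (w : H1 Ω) : L2v Ω := (w : WithLp 2 (L2s Ω × L2v Ω)).snd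

/-- `∫_Ω u v dx`. -/
def massForm {n : ℕ} {Ω : Set (Sp n)} (u v : H1 Ω) : ℝ := ∫ x in Ω, val u x * val v x

/-- `∫_Ω ∇u · ∇v dx`. -/
def energyForm {n : ℕ} {Ω : Set (Sp n)} (u v : H1 Ω) : ℝ :=
  ∫ x in Ω, inner ℝ (grad u x) (grad v x)

lemma massForm_eq_inner {n : ℕ} {Ω : Set (Sp n)} (u v : H1 Ω) :
    massForm u v = inner ℝ (val u) (val v) := by
  rw [massForm, L2.inner_def]
  congr 1
  ext x
  simp [mul_comm]

lemma energyForm_eq_inner {n : ℕ} {Ω : Set (Sp n)} (u v : H1 Ω) :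
    energyForm u v = inner ℝ (grad u) (grad v) := by
  rw [energyForm, L2.inner_def]

/-- The restrictions to `Ω` of the functions in `C_c^∞(U)`, as elements of `H¹(Ω)`. -/
def testRestrictions {n : ℕ} (Ω U : Set (Sp n)) : Submodule ℝ (H1 Ω) where
  carrier := {w | ∃ ψ : Sp n → ℝ, IsTest U ψ ∧
    val w =ᵐ[volume.restrict Ω] ψ ∧ grad w =ᵐ[volume.restrict Ω] gradient ψ}
  zero_mem' := by
    refine ⟨fun _ => 0, ⟨contDiff_const, HasCompactSupport.zero, by simp [tsupport]⟩, ?_, ?_⟩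
    · exact Lp.coeFn_zero ℝ 2 (volume.restrict Ω)
    · filter_upwards [Lp.coeFn_zero (Sp n) 2 (volume.restrict Ω)] with x hx
      rw [gradient_fun_const]
      exact hx
  add_mem' := by
    rintro a b ⟨ψ, hψ, h1, h2⟩ ⟨χ, hχ, k1, k2⟩
    refine ⟨ψ + χ, ⟨hψ.1.add hχ.1, hψ.2.1.add hχ.2.1,
      (tsupport_add ψ χ).trans (union_subset hψ.2.2 hχ.2.2)⟩, ?_, ?_⟩
    · filter_upwards [Lp.coeFn_add (val a) (val b), h1, k1] with x hx y z
      refine hx.trans ?_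
      rw [Pi.add_apply, y, z, Pi.add_apply]
    · filter_upwards [Lp.coeFn_add (grad a) (grad b), h2, k2] with x hx y z
      refine hx.trans ?_
      rw [Pi.add_apply, y, z, gradient, gradient, gradient,
        fderiv_add (hψ.1.differentiable (by simp) x) (hχ.1.differentiable (by simp) x), map_add]
  smul_mem' := by
    rintro c a ⟨ψ, hψ, h1, h2⟩
    refine ⟨c • ψ, ⟨hψ.1.const_smul c, hψ.2.1.smul_left (f := fun _ => c),
      (tsupport_smul_subset_right (fun _ => c) ψ).trans hψ.2.2⟩, ?_, ?_⟩
    · filter_upwards [Lp.coeFn_smul c (val a), h1] with x hx y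
      refine hx.trans ?_
      rw [Pi.smul_apply, y, Pi.smul_apply]
    · filter_upwards [Lp.coeFn_smul c (grad a), h2] with x hx y
      refine hx.trans ?_
      rw [Pi.smul_apply, y, gradient, gradient,
        fderiv_const_smul (hψ.1.differentiable (by simp) x) c]
      simp

/-- `H¹_0(Ω)`: the closure of `C_c^∞(Ω)` in `H¹(Ω)`. -/
def H10 {n : ℕ} (Ω : Set (Sp n)) : Submodule ℝ (H1 Ω) :=
  (testRestrictions Ω Ω).topologicalClosure

/-- `H¹_{0,Γ}(Ω)`: the closure in `H¹(Ω)` of `C_c^∞(closure Ω \ Γ)`, that is, of the restrictions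
to `Ω` of the smooth functions with compact support in `ℝ^N \ Γ`. -/
def H10Off {n : ℕ} (Ω Γ : Set (Sp n)) : Submodule ℝ (H1 Ω) :=
  (testRestrictions Ω Γᶜ).topologicalClosure

/-- The eigenspace of the parameter `μ` for the weak problem on the form domain `V`: all `φ ∈ V`
with `∫_Ω ∇φ · ∇v = μ ∫_Ω φ v` for every `v ∈ V`. -/
def eigenspace {n : ℕ} {Ω : Set (Sp n)} (V : Submodule ℝ (H1 Ω)) (μ : ℝ) :
    Submodule ℝ (H1 Ω) where
  carrier := {φ | φ ∈ V ∧ ∀ v ∈ V, energyForm φ v = μ * massForm φ v}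
  zero_mem' := by
    refine ⟨V.zero_mem, fun v _ => ?_⟩
    rw [energyForm_eq_inner, massForm_eq_inner]
    simp [val, grad]
  add_mem' := by
    rintro a b ⟨ha, ha'⟩ ⟨hb, hb'⟩
    refine ⟨V.add_mem ha hb, fun v hv => ?_⟩
    have h1 := ha' v hv
    have h2 := hb' v hv
    simp only [energyForm_eq_inner, massForm_eq_inner, val, grad, Submodule.coe_add,
      WithLp.add_fst, WithLp.add_snd, inner_add_left] at h1 h2 ⊢
    rw [h1, h2]
    ring
  smul_mem' := by
    rintro c a ⟨ha, ha'⟩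
    refine ⟨V.smul_mem c ha, fun v hv => ?_⟩
    have h1 := ha' v hv
    simp only [energyForm_eq_inner, massForm_eq_inner, val, grad, Submodule.coe_smul,
      WithLp.smul_fst, WithLp.smul_snd, real_inner_smul_left] at h1 ⊢
    rw [h1]
    ring

/-- The `i`-th eigenvalue (`i ≥ 1`) of the weak problem on `V`, in increasing order and repeated
according to multiplicity: the smallest `t` such that the eigenvalues in `(-∞, t]` have total
multiplicity at least `i`. -/
def nthEigenvalue {n : ℕ} {Ω : Set (Sp n)} (V : Submodule ℝ (H1 Ω)) (i : ℕ) : ℝ :=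
  sInf {t : ℝ | (i : Cardinal) ≤ Module.rank ℝ ↥(⨆ μ ∈ Iic t, eigenspace V μ)}

/-- The Neumann region `Σ_ε = (ε 𝒱) ∩ ∂Ω`. -/
def neumannRegion {n : ℕ} (Ω 𝒱 : Set (Sp n)) (ε : ℝ) : Set (Sp n) := (ε • 𝒱) ∩ frontier Ω

/-- The form domain `H¹_{0, ∂Ω \ Σ_ε}(Ω)` of the problem with mixed boundary conditions. -/
def mixedSpace {n : ℕ} (Ω 𝒱 : Set (Sp n)) (ε : ℝ) : Submodule ℝ (H1 Ω) :=
  H10Off Ω (frontier Ω \ neumannRegion Ω 𝒱 ε)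

end MixedEigen

end

open MixedEigen

/-! The Neumann part shrinks to a point, and in dimension at least three a point has zero capacity:
a bounded sequence in the mixed spaces with `ε → 0` can only converge weakly to an element of
`H¹_0(Ω)` (`mem_H10_of_weakTendsto`). Together with a compact embedding into `L²` common to all
small `ε`, this gives convergence of eigenvalues and eigenfunctions by a variational argument.

Compactness. For `ε < 1/2` every mixed space lies in one space `W` of functions vanishing on `∂Ω`
off `B_{r₀/2}`. The rest of `∂Ω` may be irregular, so Rellich's theorem is proved by hand. The
extension of a test function by zero jumps only across the graph part of the boundary, and there is
a small ball of upward translations `h` along which no segment starting in `Ω` meets that part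
(`IsC11NearOrigin.hasInwardDirections`). Hence translation by `h` costs at most `|h| ‖∇ψ‖` in
`L²(Ω)`, and `ψ` is close to its local averages, which converge pointwise under weak convergence
(`compactVal_of_hasInwardDirections`).

Capacity. A test function `z` is replaced by a cutoff vanishing on `B_ρ` times the truncation `z /
(1 + ρ z²)`. The truncation is at most `1 / (2√ρ)`, so the cutoff term has energy of order `ρ⁻¹ ρ⁻²
ρ^N`, which is bounded for `N ≥ 3`. Boundedness suffices: the modified functions have a weak limit
in `H¹_0(Ω)`, and it has the same values as the original limit.

Spectrum. Having `i` eigenvalues at most `t` is equivalent, given compactness, to having `i`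
functions, orthonormal in `L²`, with Rayleigh quotient at most `t` on their span
(`hasLowFamily_of_le_rank`, `le_rank_of_hasLowFamily`). Inclusion of spaces gives `λ_i^ε ≤ λ_i`;
passing such families to the limit gives the reverse bound (`HasLowFamily.of_tendsto`). A weak limit
of the `φ_i^ε` is then a normalized eigenfunction for `λ_i`, equal to `φ_i` by simplicity and the
sign condition. Since `‖φ_i^ε‖² = 1 + λ_i^ε` converges to `1 + λ_i = ‖φ_i‖²`, the convergence is
strong. -/

noncomputable section

namespace MixedEigen

/-! ### Weak convergence in Hilbert spaces. -/

section WeakConvergence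

variable {H : Type*} [NormedAddCommGroup H] [InnerProductSpace ℝ H]

/-- Weak convergence of a sequence in a real inner product space. -/
def WeakTendsto (u : ℕ → H) (w : H) : Prop :=
  ∀ v : H, Tendsto (fun k => inner ℝ (u k) v) atTop (𝓝 (inner ℝ w v))

lemma WeakTendsto.comp {u : ℕ → H} {w : H} (h : WeakTendsto u w) {s : ℕ → ℕ}
    (hs : Tendsto s atTop atTop) : WeakTendsto (u ∘ s) w :=
  fun v => (h v).comp hs

lemma WeakTendsto.sub_const {u : ℕ → H} {w : H} (h : WeakTendsto u w) (z : H) :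
    WeakTendsto (fun k => u k - z) (w - z) := by
  intro v
  simp only [inner_sub_left]
  exact (h v).sub tendsto_const_nhds

lemma WeakTendsto.add_tendsto_zero {u e : ℕ → H} {w : H} (h : WeakTendsto u w)
    (he : Tendsto e atTop (𝓝 0)) : WeakTendsto (fun k => u k + e k) w := by
  intro v
  simp only [inner_add_left]
  simpa using (h v).add (he.inner (tendsto_const_nhds (x := v)))

lemma WeakTendsto.finset_sum {ι : Type*} (s : Finset ι) {u : ι → ℕ → H} {w : ι → H}
    (h : ∀ j ∈ s, WeakTendsto (u j) (w j)) (a : ι → ℝ) :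
    WeakTendsto (fun k => ∑ j ∈ s, a j • u j k) (∑ j ∈ s, a j • w j) := by
  intro v
  simp only [sum_inner, real_inner_smul_left]
  exact tendsto_finsetSum _ fun j hj => (h j hj v).const_mul _

/-- A closed subspace equals its double orthogonal complement, hence is cut out by weakly continuous
conditions. -/
lemma WeakTendsto.mem_of_isClosed [CompleteSpace H] {V : Submodule ℝ H}
    (hV : IsClosed (V : Set H)) {u : ℕ → H} {w : H} (h : WeakTendsto u w)
    (hu : ∀ᶠ k in atTop, u k ∈ V) : w ∈ V := by
  have : V = Vᗮᗮ := by
    rw [Submodule.orthogonal_orthogonal_eq_closure, hV.submodule_topologicalClosure_eq]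
  rw [this, Submodule.mem_orthogonal']
  intro v hv
  refine tendsto_nhds_unique (h v) (tendsto_const_nhds.congr' ?_)
  filter_upwards [hu] with k hk
  exact (Submodule.inner_right_of_mem_orthogonal hk hv).symm

/-- Weak lower semicontinuity of the norm, from `2⟪u, w⟫ - ‖w‖² ≤ ‖u‖²`. -/
lemma WeakTendsto.norm_sq_le_of_tendsto {u : ℕ → H} {w : H} (h : WeakTendsto u w) {c : ℕ → ℝ}
    {C : ℝ} (hc : Tendsto c atTop (𝓝 C)) (hu : ∀ k, ‖u k‖ ^ 2 ≤ c k) : ‖w‖ ^ 2 ≤ C := by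
  have h1 : Tendsto (fun k => 2 * inner ℝ (u k) w - ‖w‖ ^ 2) atTop (𝓝 (‖w‖ ^ 2)) := by
    have := ((h w).const_mul 2).sub_const (‖w‖ ^ 2)
    rw [real_inner_self_eq_norm_sq] at this
    convert this using 2
    ring
  refine le_of_tendsto_of_tendsto' h1 hc fun k => (le_trans ?_ (hu k))
  have := sq_nonneg ‖u k - w‖
  rw [norm_sub_sq_real] at this
  linarith

lemma WeakTendsto.tendsto_of_norm_sq {u : ℕ → H} {w : H} (h : WeakTendsto u w)
    (hn : Tendsto (fun k => ‖u k‖ ^ 2) atTop (𝓝 (‖w‖ ^ 2))) : Tendsto u atTop (𝓝 w) := by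
  rw [tendsto_iff_norm_sub_tendsto_zero]
  have h1 : Tendsto (fun k => ‖u k - w‖ ^ 2) atTop (𝓝 0) := by
    simp only [norm_sub_sq_real]
    have := (hn.sub ((h w).const_mul 2)).add_const (‖w‖ ^ 2)
    rw [real_inner_self_eq_norm_sq] at this
    convert this using 2
    ring
  have h2 := h1.sqrt
  simpa [Real.sqrt_sq_eq_abs] using h2

/-- Bounded sequences in a separable Hilbert space have weakly convergent subsequences. -/
lemma exists_weakTendsto_subseq [CompleteSpace H] [TopologicalSpace.SeparableSpace H]
    {u : ℕ → H} {C : ℝ} (hu : ∀ k, ‖u k‖ ≤ C) :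
    ∃ w : H, ∃ s : ℕ → ℕ, StrictMono s ∧ WeakTendsto (u ∘ s) w := by
  -- Sequential Banach–Alaoglu, carried over by the Riesz isomorphism.
  have hc := WeakDual.isSeqCompact_closedBall ℝ H 0 C
  obtain ⟨f, -, s, hs, hf⟩ := hc (x := fun k => StrongDual.toWeakDual
    (InnerProductSpace.toDual ℝ H (u k))) (fun k => by simpa using hu k)
  refine ⟨(InnerProductSpace.toDual ℝ H).symm (WeakDual.toStrongDual f), s, hs, fun v => ?_⟩
  have := (WeakDual.eval_continuous v).continuousAt.tendsto.comp hf
  rw [InnerProductSpace.toDual_symm_apply]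
  exact this

/-- Finitely many bounded sequences have a common weakly convergent subsequence. -/
lemma exists_weakTendsto_subseq_fin [CompleteSpace H] [TopologicalSpace.SeparableSpace H] {C : ℝ} :
    ∀ (i : ℕ) (u : Fin i → ℕ → H), (∀ j k, ‖u j k‖ ≤ C) →
      ∃ w : Fin i → H, ∃ s : ℕ → ℕ, StrictMono s ∧ ∀ j, WeakTendsto (u j ∘ s) (w j)
  | 0, _, _ => ⟨fun j => j.elim0, id, strictMono_id, fun j => j.elim0⟩
  | i + 1, u, hu => by
    obtain ⟨w, s, hs, hw⟩ := exists_weakTendsto_subseq_fin i (fun j => u j.succ)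
      fun j k => hu j.succ k
    obtain ⟨w₀, t, ht, hw₀⟩ := exists_weakTendsto_subseq (u := u 0 ∘ s) fun k => hu 0 (s k)
    refine ⟨Fin.cons w₀ w, s ∘ t, hs.comp ht, fun j => ?_⟩
    refine Fin.cases ?_ (fun j => ?_) j
    · exact hw₀
    · exact (hw j).comp ht.tendsto_atTop

end WeakConvergence

/-! ### The Hilbert space structure of `H¹(Ω)`. -/

section Sobolev

variable {n : ℕ} {Ω : Set (Sp n)}

lemma inner_eq_massForm_add_energyForm (u v : H1 Ω) :
    inner ℝ u v = massForm u v + energyForm u v := by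
  rw [massForm_eq_inner, energyForm_eq_inner, Submodule.coe_inner, WithLp.prod_inner_apply]
  rfl

/-- `u ↦ u` as a continuous linear map from `H¹(Ω)` to `L²(Ω)`. -/
def valL (Ω : Set (Sp n)) : H1 Ω →L[ℝ] L2s Ω :=
  (WithLp.fstL 2 ℝ (L2s Ω) (L2v Ω)).comp (H1 Ω).subtypeL

/-- `u ↦ ∇u` as a continuous linear map from `H¹(Ω)` to `L²(Ω; ℝ^N)`. -/
def gradL (Ω : Set (Sp n)) : H1 Ω →L[ℝ] L2v Ω :=
  (WithLp.sndL 2 ℝ (L2s Ω) (L2v Ω)).comp (H1 Ω).subtypeL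

lemma valL_apply (u : H1 Ω) : valL Ω u = val u := rfl

lemma gradL_apply (u : H1 Ω) : gradL Ω u = grad u := rfl

lemma massForm_eq_inner_valL (u v : H1 Ω) : massForm u v = inner ℝ (valL Ω u) (valL Ω v) :=
  massForm_eq_inner u v

lemma massForm_self (u : H1 Ω) : massForm u u = ‖val u‖ ^ 2 := by
  rw [massForm_eq_inner, real_inner_self_eq_norm_sq]

lemma energyForm_self (u : H1 Ω) : energyForm u u = ‖grad u‖ ^ 2 := by
  rw [energyForm_eq_inner, real_inner_self_eq_norm_sq]

lemma norm_sq_eq (u : H1 Ω) : ‖u‖ ^ 2 = ‖val u‖ ^ 2 + ‖grad u‖ ^ 2 := by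
  rw [← real_inner_self_eq_norm_sq, inner_eq_massForm_add_energyForm, massForm_self,
    energyForm_self]

lemma norm_val_le (u : H1 Ω) : ‖val u‖ ≤ ‖u‖ := by
  refine (pow_le_pow_iff_left₀ (norm_nonneg _) (norm_nonneg _) two_ne_zero).1 ?_
  rw [norm_sq_eq]; nlinarith [sq_nonneg ‖grad u‖]

lemma norm_grad_le (u : H1 Ω) : ‖grad u‖ ≤ ‖u‖ := by
  refine (pow_le_pow_iff_left₀ (norm_nonneg _) (norm_nonneg _) two_ne_zero).1 ?_
  rw [norm_sq_eq]; nlinarith [sq_nonneg ‖val u‖]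

/-- For each test function the defining identity compares `L²` inner products with fixed functions,
so it is a closed condition. -/
lemma isClosed_H1 (Ω : Set (Sp n)) : IsClosed (H1 Ω : Set (WithLp 2 (L2s Ω × L2v Ω))) := by
  have : (H1 Ω : Set (WithLp 2 (L2s Ω × L2v Ω))) = ⋂ (ψ : Sp n → ℝ) (_ : IsTest Ω ψ) (v : Sp n),
      {w | ∫ x in Ω, w.fst x * fderiv ℝ ψ x v = - ∫ x in Ω, inner ℝ (w.snd x) v * ψ x} := by
    ext w
    simp only [mem_iInter, SetLike.mem_coe]
    rfl
  rw [this]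
  refine isClosed_iInter fun ψ => isClosed_iInter fun hψ => isClosed_iInter fun v => ?_
  have hc : Continuous (fun x => fderiv ℝ ψ x v) :=
    (hψ.1.continuous_fderiv (by simp)).clm_apply continuous_const
  have hs : HasCompactSupport (fun x => fderiv ℝ ψ x v) := hψ.2.1.fderiv_apply (𝕜 := ℝ) v
  have m1 : MemLp (fun x => fderiv ℝ ψ x v) 2 (volume.restrict Ω) :=
    (hc.memLp_of_hasCompactSupport hs).restrict Ω
  have hc2 : Continuous (fun x => ψ x • v) := hψ.1.continuous.smul continuous_const
  have hs2 : HasCompactSupport (fun x => ψ x • v) := hψ.2.1.smul_right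
  have m2 : MemLp (fun x => ψ x • v) 2 (volume.restrict Ω) :=
    (hc2.memLp_of_hasCompactSupport hs2).restrict Ω
  have e1 : ∀ w : WithLp 2 (L2s Ω × L2v Ω), ∫ x in Ω, w.fst x * fderiv ℝ ψ x v
      = inner ℝ w.fst m1.toLp := by
    intro w
    rw [L2.inner_def]
    refine integral_congr_ae ?_
    filter_upwards [m1.coeFn_toLp] with x hx
    rw [hx]; simp [mul_comm]
  have e2 : ∀ w : WithLp 2 (L2s Ω × L2v Ω), ∫ x in Ω, inner ℝ (w.snd x) v * ψ x
      = inner ℝ w.snd m2.toLp := by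
    intro w
    rw [L2.inner_def]
    refine integral_congr_ae ?_
    filter_upwards [m2.coeFn_toLp] with x hx
    rw [hx, real_inner_smul_right, mul_comm]
  simp only [e1, e2]
  refine isClosed_eq ?_ ?_
  · exact (WithLp.fstL 2 ℝ (L2s Ω) (L2v Ω)).continuous.inner continuous_const
  · exact ((WithLp.sndL 2 ℝ (L2s Ω) (L2v Ω)).continuous.inner continuous_const).neg

instance : CompleteSpace (H1 Ω) := (isClosed_H1 Ω).completeSpace_coe

instance : Fact ((2 : ENNReal) ≠ ⊤) := ⟨by simp⟩

instance : TopologicalSpace.SeparableSpace (WithLp 2 (L2s Ω × L2v Ω)) := by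
  have h1 : SecondCountableTopology (L2s Ω) := inferInstance
  have h2 : SecondCountableTopology (L2v Ω) := inferInstance
  have h3 : SecondCountableTopology (L2s Ω × L2v Ω) := inferInstance
  exact (WithLp.prodContinuousLinearEquiv 2 ℝ
    (L2s Ω) (L2v Ω)).symm.surjective.denseRange.separableSpace
      (WithLp.prodContinuousLinearEquiv 2 ℝ (L2s Ω) (L2v Ω)).symm.continuous

instance : TopologicalSpace.SeparableSpace (H1 Ω) :=
  have := UniformSpace.secondCountable_of_separable (WithLp 2 (L2s Ω × L2v Ω))
  inferInstance

lemma WeakTendsto.val {u : ℕ → H1 Ω} {w : H1 Ω} (h : WeakTendsto u w) :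
    WeakTendsto (fun k => val (u k)) (val w) := by
  intro f
  have := h ((valL Ω).adjoint f)
  simp only [ContinuousLinearMap.adjoint_inner_right] at this
  exact this

end Sobolev

/-- An `i`-dimensional piece of the image of `J` has an orthonormal basis, which is lifted back to
`M`. With `J` the embedding into `L²`, this orthonormalizes elements of `H¹` in the weaker norm. -/
lemma exists_orthonormal_comp_of_le_rank {M K : Type*} [AddCommGroup M] [Module ℝ M]
    [NormedAddCommGroup K] [InnerProductSpace ℝ K] (J : M →ₗ[ℝ] K) (hJ : LinearMap.ker J = ⊥)
    {i : ℕ} (h : (i : Cardinal) ≤ Module.rank ℝ M) :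
    ∃ x : Fin i → M, Orthonormal ℝ (fun j => J (x j)) := by
  obtain ⟨s, hs, hli⟩ := le_rank_iff_exists_linearIndependent_finset.1 h
  have hli' := hli.map' J hJ
  set F : Submodule ℝ K := Submodule.span ℝ (range (J ∘ (Subtype.val : s → M)))
  have hF : Module.finrank ℝ F = i := by
    refine (finrank_span_eq_card hli').trans ?_
    simpa using hs
  have : FiniteDimensional ℝ F := FiniteDimensional.span_of_finite ℝ (finite_range _)
  have hFJ : F ≤ LinearMap.range J := by
    refine Submodule.span_le.2 ?_
    rintro _ ⟨x, rfl⟩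
    exact ⟨x, rfl⟩
  set b := (stdOrthonormalBasis ℝ F).reindex (finCongr hF)
  choose x hx using fun j => hFJ (b j).2
  refine ⟨x, ?_⟩
  simp only [hx]
  exact b.orthonormal.comp_linearIsometry F.subtypeₗᵢ

/-! ### Variational description of the eigenvalues. -/

section Spectral

variable {n : ℕ} {Ω : Set (Sp n)}

/-- The embedding of `V` into `L²(Ω)` maps bounded weakly convergent sequences to convergent
ones. -/
def CompactVal (V : Submodule ℝ (H1 Ω)) : Prop :=
  ∀ (u : ℕ → H1 Ω) (w : H1 Ω) (C : ℝ), (∀ k, u k ∈ V) → (∀ k, ‖u k‖ ≤ C) → WeakTendsto u w →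
    Tendsto (fun k => val (u k)) atTop (𝓝 (val w))

lemma CompactVal.mono {V W : Submodule ℝ (H1 Ω)} (hW : CompactVal W) (h : V ≤ W) : CompactVal V :=
  fun u w C hu => hW u w C fun k => h (hu k)

lemma massForm_comm (u v : H1 Ω) : massForm u v = massForm v u := by
  rw [massForm_eq_inner, massForm_eq_inner, real_inner_comm]

lemma mem_eigenspace_iff {V : Submodule ℝ (H1 Ω)} {μ : ℝ} {φ : H1 Ω} :
    φ ∈ eigenspace V μ ↔ φ ∈ V ∧ ∀ v ∈ V, inner ℝ φ v = (1 + μ) * massForm φ v := by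
  have : φ ∈ eigenspace V μ ↔ φ ∈ V ∧ ∀ v ∈ V, energyForm φ v = μ * massForm φ v := Iff.rfl
  rw [this]
  refine and_congr_right fun _ => forall₂_congr fun v _ => ?_
  rw [inner_eq_massForm_add_energyForm]
  constructor <;> intro h <;> linarith

/-- The span of the eigenfunctions on `V` with eigenvalues at most `t`. -/
def lowSpace (V : Submodule ℝ (H1 Ω)) (t : ℝ) : Submodule ℝ (H1 Ω) :=
  ⨆ μ ∈ Iic t, eigenspace V μ

lemma eigenspace_le_lowSpace (V : Submodule ℝ (H1 Ω)) {μ t : ℝ} (h : μ ≤ t) :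
    eigenspace V μ ≤ lowSpace V t :=
  le_iSup₂_of_le (f := fun μ (_ : μ ∈ Iic t) => eigenspace V μ) μ h le_rfl

lemma lowSpace_le (V : Submodule ℝ (H1 Ω)) (t : ℝ) : lowSpace V t ≤ V :=
  iSup₂_le fun _ _ _ hφ => hφ.1

lemma lowSpace_mono (V : Submodule ℝ (H1 Ω)) {s t : ℝ} (h : s ≤ t) :
    lowSpace V s ≤ lowSpace V t :=
  iSup₂_le fun _ hμ => eigenspace_le_lowSpace V (le_trans hμ h)

lemma massForm_eq_zero_of_ne {V : Submodule ℝ (H1 Ω)} {μ ν : ℝ} (hne : μ ≠ ν) {φ χ : H1 Ω}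
    (hφ : φ ∈ eigenspace V μ) (hχ : χ ∈ eigenspace V ν) : massForm φ χ = 0 := by
  have h1 := (mem_eigenspace_iff.1 hφ).2 χ hχ.1
  have h2 := (mem_eigenspace_iff.1 hχ).2 φ hφ.1
  rw [real_inner_comm, massForm_comm χ φ, h1] at h2
  have : (μ - ν) * massForm φ χ = 0 := by linarith
  exact (mul_eq_zero.1 this).resolve_left (sub_ne_zero.2 hne)

/-- Eigenfunctions with distinct eigenvalues are orthogonal for both forms, so both squared norms of
a sum split into diagonal terms, compared one by one. -/
lemma norm_sq_le_of_mem_lowSpace {V : Submodule ℝ (H1 Ω)} {t : ℝ} {u : H1 Ω}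
    (hu : u ∈ lowSpace V t) : ‖u‖ ^ 2 ≤ (1 + t) * ‖val u‖ ^ 2 := by
  rw [lowSpace, iSup_subtype', Submodule.mem_iSup_iff_exists_finsupp] at hu
  obtain ⟨f, hf, rfl⟩ := hu
  have hdiag : ∀ a ∈ f.support, ∀ b ∈ f.support, b ≠ a → massForm (f a) (f b) = 0 :=
    fun a _ b _ hab => massForm_eq_zero_of_ne (fun h => hab (Subtype.ext h.symm)) (hf a) (hf b)
  have h1 : ‖val (f.sum fun _ x => x)‖ ^ 2 = ∑ a ∈ f.support, massForm (f a) (f a) := by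
    rw [← massForm_self, massForm_eq_inner_valL, Finsupp.sum, map_sum, sum_inner]
    refine Finset.sum_congr rfl fun a ha => ?_
    rw [inner_sum, Finset.sum_eq_single a]
    · rw [massForm_eq_inner_valL]
    · intro b hb hab
      rw [← massForm_eq_inner_valL, hdiag a ha b hb hab]
    · exact fun h => (h ha).elim
  have h2 : ‖f.sum fun _ x => x‖ ^ 2 = ∑ a ∈ f.support, (1 + (a : ℝ)) * massForm (f a) (f a) := by
    rw [← real_inner_self_eq_norm_sq, Finsupp.sum, sum_inner]
    refine Finset.sum_congr rfl fun a ha => ?_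
    rw [inner_sum, Finset.sum_eq_single a]
    · exact (mem_eigenspace_iff.1 (hf a)).2 _ (hf a).1
    · intro b hb hab
      rw [(mem_eigenspace_iff.1 (hf a)).2 _ (hf b).1, hdiag a ha b hb hab, mul_zero]
    · exact fun h => (h ha).elim
  rw [h1, h2, Finset.mul_sum]
  refine Finset.sum_le_sum fun a _ => mul_le_mul_of_nonneg_right ?_ ?_
  · have := a.2; simp only [mem_Iic] at this; linarith
  · rw [massForm_self]; positivity

/-- There are `i` functions in `V`, orthonormal in `L²(Ω)`, on whose span the Rayleigh quotient
is at most `t`. -/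
def HasLowFamily (V : Submodule ℝ (H1 Ω)) (i : ℕ) (t : ℝ) : Prop :=
  ∃ u : Fin i → H1 Ω, (∀ j, u j ∈ V) ∧ Orthonormal ℝ (fun j => val (u j)) ∧
    ∀ a : Fin i → ℝ, ‖∑ j, a j • u j‖ ^ 2 ≤ (1 + t) * ‖val (∑ j, a j • u j)‖ ^ 2

lemma HasLowFamily.mono {V W : Submodule ℝ (H1 Ω)} {i : ℕ} {t : ℝ} (h : HasLowFamily V i t)
    (hVW : V ≤ W) : HasLowFamily W i t := by
  obtain ⟨u, h1, h2, h3⟩ := h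
  exact ⟨u, fun j => hVW (h1 j), h2, h3⟩

lemma hasLowFamily_of_le_rank {V : Submodule ℝ (H1 Ω)} {i : ℕ} {t : ℝ}
    (h : (i : Cardinal) ≤ Module.rank ℝ (lowSpace V t)) : HasLowFamily V i t := by
  set J : lowSpace V t →ₗ[ℝ] L2s Ω := (valL Ω).toLinearMap ∘ₗ (lowSpace V t).subtype with hJ
  have hker : LinearMap.ker J = ⊥ := by
    rw [LinearMap.ker_eq_bot']
    intro x hx
    have h1 := norm_sq_le_of_mem_lowSpace x.2
    have h2 : val (x : H1 Ω) = 0 := hx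
    rw [h2, norm_zero] at h1
    have h3 : ‖(x : H1 Ω)‖ = 0 := by nlinarith [norm_nonneg (x : H1 Ω)]
    exact Subtype.ext (norm_eq_zero.1 h3)
  obtain ⟨x, hx⟩ := exists_orthonormal_comp_of_le_rank J hker h
  exact ⟨fun j => x j, fun j => lowSpace_le V t (x j).2, hx, fun a => norm_sq_le_of_mem_lowSpace
    (Submodule.sum_mem _ fun j _ => Submodule.smul_mem _ _ (x j).2)⟩

/-- On a closed subspace with compact embedding into `L²(Ω)`, the Rayleigh quotient
`‖u‖²_{L²} / ‖u‖²_{H¹}` has a maximizer. -/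
lemma exists_rayleigh_maximizer {V : Submodule ℝ (H1 Ω)} (hV : IsClosed (V : Set (H1 Ω)))
    (hc : CompactVal V) {u₀ : H1 Ω} (hu₀ : u₀ ∈ V) (hval : val u₀ ≠ 0) :
    ∃ w ∈ V, w ≠ 0 ∧ ∃ S : ℝ, 0 < S ∧ (∀ v ∈ V, ‖val v‖ ^ 2 ≤ S * ‖v‖ ^ 2) ∧
      ∀ v ∈ V, massForm w v = S * inner ℝ w v := by
  set A : Set ℝ := (fun v => ‖val v‖ ^ 2) '' {v | v ∈ V ∧ ‖v‖ ≤ 1} with hA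
  have hbdd : BddAbove A := by
    refine ⟨1, ?_⟩
    rintro _ ⟨v, ⟨-, hv⟩, rfl⟩
    exact pow_le_one₀ (norm_nonneg _) ((norm_val_le v).trans hv)
  have hne : A.Nonempty := ⟨_, 0, ⟨V.zero_mem, by simp⟩, rfl⟩
  set S := sSup A
  have hmax : ∀ v ∈ V, ‖val v‖ ^ 2 ≤ S * ‖v‖ ^ 2 := by
    intro v hv
    rcases eq_or_ne v 0 with rfl | h0
    · have : val (0 : H1 Ω) = 0 := (valL Ω).map_zero
      simp [this]
    · have hn : 0 < ‖v‖ := norm_pos_iff.2 h0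
      have h1 : ‖val (‖v‖⁻¹ • v)‖ ^ 2 ≤ S :=
        le_csSup hbdd ⟨‖v‖⁻¹ • v, ⟨V.smul_mem _ hv, by
          rw [norm_smul, norm_inv, norm_norm, inv_mul_cancel₀ hn.ne']⟩, rfl⟩
      have h2 : val (‖v‖⁻¹ • v) = ‖v‖⁻¹ • val v := (valL Ω).map_smul _ _
      rw [h2, norm_smul, norm_inv, norm_norm, mul_pow, inv_pow, inv_mul_le_iff₀ (by positivity)]
        at h1
      linarith
  have hS : 0 < S := by
    have h1 := hmax u₀ hu₀
    have h2 : 0 < ‖val u₀‖ ^ 2 := by have := norm_pos_iff.2 hval; positivity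
    by_contra hS
    nlinarith [sq_nonneg ‖u₀‖]
  obtain ⟨x, -, hx, hxA⟩ := exists_seq_tendsto_sSup hne hbdd
  choose v hv hvx using hxA
  obtain ⟨w, s, hs, hw⟩ := exists_weakTendsto_subseq (u := v) (C := 1) fun k => (hv k).2
  have hwV : w ∈ V := hw.mem_of_isClosed hV (Eventually.of_forall fun k => (hv (s k)).1)
  have hvalw := hc _ w 1 (fun k => (hv (s k)).1) (fun k => (hv (s k)).2) hw
  have hwS : ‖val w‖ ^ 2 = S := by
    refine tendsto_nhds_unique (hvalw.norm.pow 2) ((hx.comp hs.tendsto_atTop).congr fun k => ?_)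
    exact (hvx (s k)).symm
  have hw1 : ‖w‖ ^ 2 ≤ 1 := by
    refine hw.norm_sq_le_of_tendsto tendsto_const_nhds fun k => ?_
    exact pow_le_one₀ (norm_nonneg _) (hv (s k)).2
  -- The supremum is attained: `‖w‖ ≤ 1` by weak lower semicontinuity, while compactness gives `‖val
  -- w‖² = S`.
  have hw0 : S * ‖w‖ ^ 2 = ‖val w‖ ^ 2 :=
    le_antisymm (by rw [hwS]; nlinarith) (hmax w hwV)
  refine ⟨w, hwV, ?_, S, hS, hmax, fun v hv => ?_⟩
  · rintro rfl
    rw [norm_zero, hwS] at hw0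
    norm_num at hw0
    exact hS.ne hw0
  · set B := S * inner ℝ w v - massForm w v with hB
    -- First variation at the maximizer: a nonnegative quadratic in `t` without constant term has no
    -- linear term either.
    have hq : ∀ t : ℝ, 0 ≤ (S * ‖v‖ ^ 2 - ‖val v‖ ^ 2) * (t * t) + (2 * B) * t + 0 := by
      intro t
      have h1 := hmax (w + t • v) (V.add_mem hwV (V.smul_mem t hv))
      have h2 : val (w + t • v) = val w + t • val v := by
        simp only [← valL_apply, map_add, map_smul]
      have h3 : inner ℝ w (t • v) = t * inner ℝ w v := real_inner_smul_right w v t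
      have h4 : ‖t • v‖ ^ 2 = t ^ 2 * ‖v‖ ^ 2 := by
        rw [norm_smul, mul_pow, Real.norm_eq_abs, sq_abs]
      rw [h2, norm_add_sq_real, norm_add_sq_real, real_inner_smul_right, h3, h4, norm_smul, mul_pow,
        Real.norm_eq_abs, sq_abs, ← massForm_eq_inner] at h1
      rw [hB]
      nlinarith
    have hd := discrim_le_zero hq
    rw [discrim] at hd
    have : B = 0 := by nlinarith
    linarith

/-- For an eigenfunction `φ`, `⟪φ, w⟫ = (1 + μ) ∫ φ w`, so orthogonality in `H¹` gives orthogonality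
in `L²`; if `1 + μ = 0` then `‖φ‖ = 0`. -/
lemma massForm_eq_zero_of_mem_orthogonal {V : Submodule ℝ (H1 Ω)} {t : ℝ} {w p : H1 Ω}
    (hwV : w ∈ V) (hw : w ∈ (lowSpace V t)ᗮ) (hp : p ∈ lowSpace V t) : massForm w p = 0 := by
  have hle : lowSpace V t ≤ LinearMap.ker
      ((innerSL ℝ (valL Ω w)).toLinearMap ∘ₗ (valL Ω).toLinearMap) := by
    refine iSup₂_le fun μ hμ φ hφ => ?_
    have h1 : inner ℝ φ w = 0 := hw φ (eigenspace_le_lowSpace V hμ hφ)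
    have h2 := (mem_eigenspace_iff.1 hφ).2
    have h3 : massForm φ w = 0 := by
      rcases eq_or_ne (1 + μ) 0 with h0 | h0
      · have h4 := h2 φ hφ.1
        rw [h0, zero_mul, inner_self_eq_zero] at h4
        rw [h4, massForm_eq_inner_valL, map_zero, inner_zero_left]
      · have h4 := h2 w hwV
        rw [h1] at h4
        exact (mul_eq_zero.1 h4.symm).resolve_left h0
    rw [massForm_comm, massForm_eq_inner_valL] at h3
    exact h3
  rw [massForm_eq_inner_valL]
  exact hle hp

/-- A family of `i` functions with Rayleigh quotients at most `t` forces `i` eigenvalues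
at most `t`, counted with multiplicity. -/
lemma le_rank_of_hasLowFamily {V : Submodule ℝ (H1 Ω)} (hV : IsClosed (V : Set (H1 Ω)))
    (hc : CompactVal V) {i : ℕ} {t : ℝ} (h : HasLowFamily V i t) :
    (i : Cardinal) ≤ Module.rank ℝ (lowSpace V t) := by
  by_contra! hlt
  set E := lowSpace V t with hE
  have hfree : Module.Free ℝ E := Module.Free.of_divisionRing ℝ E
  have hfd : FiniteDimensional ℝ E :=
    Module.rank_lt_aleph0_iff.1 (hlt.trans (Cardinal.natCast_lt_aleph0))
  have hfin : Module.finrank ℝ E < i := by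
    rw [← Module.finrank_eq_rank] at hlt
    exact_mod_cast hlt
  obtain ⟨u, huV, huo, hul⟩ := h
  set Λ : (Fin i → ℝ) →ₗ[ℝ] E :=
    E.orthogonalProjectionOnto.toLinearMap ∘ₗ Fintype.linearCombination ℝ u
  -- Dimension count: some nonzero combination `x` of the `i` functions is orthogonal to the smaller
  -- space `E`.
  have hker := LinearMap.ker_ne_bot_of_finrank_lt (f := Λ) (by simpa using hfin)
  obtain ⟨a, ha, ha0⟩ := Submodule.exists_mem_ne_zero_of_ne_bot hker
  set x : H1 Ω := ∑ j, a j • u j with hx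
  have hxE : x ∈ Eᗮ := by
    have : E.orthogonalProjectionOnto x = 0 := ha
    exact Submodule.orthogonalProjectionOnto_eq_zero_iff.1 this
  have hxV : x ∈ V := Submodule.sum_mem _ fun j _ => V.smul_mem _ (huV j)
  have hxval : val x ≠ 0 := by
    intro h0
    have h1 : val x = ∑ j, a j • val (u j) := by
      simp only [hx, ← valL_apply, map_sum, map_smul]
    rw [h1] at h0
    exact ha0 (funext (Fintype.linearIndependent_iff.1 huo.linearIndependent a h0))
  have hV' : IsClosed ((V ⊓ Eᗮ : Submodule ℝ (H1 Ω)) : Set (H1 Ω)) :=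
    hV.inter E.isClosed_orthogonal
  obtain ⟨w, hw, hw0, S, hS, hmax, heq⟩ :=
    exists_rayleigh_maximizer hV' (hc.mono inf_le_left) (u₀ := x) ⟨hxV, hxE⟩ hxval
  -- The maximizer on `V ⊓ Eᗮ` solves the equation against all of `V`, since it is orthogonal to `E`
  -- in both `H¹` and `L²`. Its eigenvalue exceeds `t`, as otherwise it would lie in `E`; this
  -- contradicts the Rayleigh quotient of `x`.
  have hweig : w ∈ eigenspace V (1 / S - 1) := by
    refine mem_eigenspace_iff.2 ⟨hw.1, fun v hv => ?_⟩
    set p : H1 Ω := (E.orthogonalProjectionOnto v).1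
    have hpE : p ∈ E := (E.orthogonalProjectionOnto v).2
    have hpV : p ∈ V := lowSpace_le V t hpE
    have h1 := heq (v - p) ⟨V.sub_mem hv hpV, Submodule.sub_starProjection_mem_orthogonal v⟩
    have h2 : massForm w p = 0 := massForm_eq_zero_of_mem_orthogonal hw.1 hw.2 hpE
    have h3 : inner ℝ w p = 0 := Submodule.inner_left_of_mem_orthogonal hpE hw.2
    rw [inner_sub_right, h3, sub_zero, massForm_eq_inner_valL, map_sub, inner_sub_right,
      ← massForm_eq_inner_valL, ← massForm_eq_inner_valL, h2, sub_zero] at h1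
    rw [h1]
    field_simp
    ring
  have ht : t < 1 / S - 1 := by
    by_contra! hle
    have h1 := eigenspace_le_lowSpace V hle hweig
    exact hw0 (inner_self_eq_zero.1 (hw.2 w h1))
  have h1 := hmax x ⟨hxV, hxE⟩
  have h2 := hul a
  have h3 : (1 + t) * S < 1 := by
    rw [← lt_div_iff₀ hS]; linarith
  have h4 : 0 < ‖val x‖ ^ 2 := by have := norm_pos_iff.2 hxval; positivity
  nlinarith

/-- Low families pass to the limit along subspaces with compact embedding. -/
lemma HasLowFamily.of_tendsto {W V : Submodule ℝ (H1 Ω)} (hc : CompactVal W)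
    {Vk : ℕ → Submodule ℝ (H1 Ω)} (hVk : ∀ k, Vk k ≤ W)
    (hlim : ∀ (s : ℕ → ℕ), StrictMono s → ∀ (u : ℕ → H1 Ω) (w : H1 Ω) (C : ℝ),
      (∀ k, u k ∈ Vk (s k)) → (∀ k, ‖u k‖ ≤ C) → WeakTendsto u w → w ∈ V)
    {i : ℕ} {t : ℕ → ℝ} {T : ℝ} (ht : Tendsto t atTop (𝓝 T)) (h : ∀ k, HasLowFamily (Vk k) i (t k)) :
    HasLowFamily V i T := by
  choose u hu huo hul using h
  obtain ⟨B, hB⟩ := ht.bddAbove_range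
  -- A coordinate vector as coefficients gives `‖u k j‖² ≤ 1 + t k`; then `x ≤ 1 + x²` removes the
  -- square.
  have hbound : ∀ j k, ‖u k j‖ ≤ 1 + (1 + B) := by
    intro j k
    have h1 := hul k (Pi.single j 1)
    have h2 : ∑ l, (Pi.single j 1 : Fin i → ℝ) l • u k l = u k j := by
      rw [Finset.sum_eq_single j] <;> simp +contextual
    have h3 : ‖val (u k j)‖ = 1 := (huo k).1 j
    rw [h2, h3] at h1
    have h4 : t k ≤ B := hB ⟨k, rfl⟩
    nlinarith [sq_nonneg (‖u k j‖ - 1)]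
  obtain ⟨w, s, hs, hw⟩ := exists_weakTendsto_subseq_fin i (fun j k => u k j) hbound
  have hval : ∀ j, Tendsto (fun k => val (u (s k) j)) atTop (𝓝 (val (w j))) := fun j =>
    hc _ _ _ (fun k => hVk _ (hu (s k) j)) (fun k => hbound j (s k)) (hw j)
  refine ⟨w, fun j => hlim s hs _ _ _ (fun k => hu (s k) j) (fun k => hbound j (s k)) (hw j),
    ?_, fun a => ?_⟩
  -- Orthonormality survives by strong `L²` convergence; the Rayleigh bound survives by lower
  -- semicontinuity on the left and strong `L²` convergence on the right.
  · rw [orthonormal_iff_ite]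
    intro j l
    refine tendsto_nhds_unique ((hval j).inner (hval l)) (tendsto_const_nhds.congr fun k => ?_)
    exact (orthonormal_iff_ite.1 (huo (s k)) j l).symm
  · have h1 : WeakTendsto (fun k => ∑ j, a j • u (s k) j) (∑ j, a j • w j) :=
      WeakTendsto.finset_sum Finset.univ (u := fun j k => u (s k) j) (fun j _ => hw j) a
    refine h1.norm_sq_le_of_tendsto ?_ fun k => hul (s k) a
    refine Tendsto.mul ((ht.comp hs.tendsto_atTop).const_add 1) (Tendsto.pow (Tendsto.norm ?_) 2)
    simp only [← valL_apply, map_sum, map_smul]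
    exact tendsto_finsetSum _ fun j _ => (hval j).const_smul (a j)

end Spectral

/-! ### Inequalities for nonnegative integrals. -/

section Lintegral

variable {α : Type*} [MeasurableSpace α] {μ : Measure α}

lemma sq_lintegral_le (f : α → ENNReal) (hf : AEMeasurable f μ) :
    (∫⁻ x, f x ∂μ) ^ 2 ≤ μ univ * ∫⁻ x, f x ^ 2 ∂μ := by
  have h := ENNReal.lintegral_mul_le_Lp_mul_Lq μ Real.HolderConjugate.two_two hf
    (aemeasurable_const (b := (1 : ENNReal)))
  simp only [Pi.mul_apply, mul_one, lintegral_const, ENNReal.rpow_two, one_pow, one_mul] at h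
  calc (∫⁻ x, f x ∂μ) ^ 2
      ≤ ((∫⁻ x, f x ^ 2 ∂μ) ^ (1 / 2 : ℝ) * μ univ ^ (1 / 2 : ℝ)) ^ 2 := by gcongr
    _ = μ univ * ∫⁻ x, f x ^ 2 ∂μ := by
      rw [mul_pow, ← ENNReal.rpow_two, ← ENNReal.rpow_two, ← ENNReal.rpow_mul, ← ENNReal.rpow_mul]
      norm_num
      rw [mul_comm]

lemma add_sq_le_two_mul (a b : ENNReal) : (a + b) ^ 2 ≤ 2 * a ^ 2 + 2 * b ^ 2 := by
  have h := ENNReal.rpow_add_le_mul_rpow_add_rpow a b (p := 2) (by norm_num)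
  norm_num [ENNReal.rpow_two] at h
  rw [← mul_add]
  exact h

lemma ofReal_norm_sq_Lp {E : Type*} [NormedAddCommGroup E] (f : Lp E 2 μ) :
    ENNReal.ofReal (‖f‖ ^ 2) = ∫⁻ x, ‖f x‖ₑ ^ 2 ∂μ := by
  rw [Lp.norm_def, ENNReal.ofReal_pow ENNReal.toReal_nonneg, ENNReal.ofReal_toReal
    (Lp.eLpNorm_ne_top f), eLpNorm_eq_lintegral_rpow_enorm_toReal two_ne_zero ENNReal.ofNat_ne_top,
    ← ENNReal.rpow_two, ← ENNReal.rpow_mul]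
  simp

end Lintegral

/-! ### Translation estimates for extensions by zero. -/

section Translation

variable {n : ℕ} {Ω : Set (Sp n)} {ψ : Sp n → ℝ}

/-- The extension by zero can be irregular only on `frontier Ω ∩ tsupport ψ`; elsewhere it coincides
locally with `ψ` or with `0`. -/
lemma indicator_eventuallyEq (hΩ : IsOpen Ω) {y : Sp n} (hy : y ∉ frontier Ω ∩ tsupport ψ) :
    (y ∈ Ω ∧ Ω.indicator ψ =ᶠ[𝓝 y] ψ) ∨ (y ∉ Ω ∧ Ω.indicator ψ =ᶠ[𝓝 y] fun _ => 0) := by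
  by_cases hyΩ : y ∈ Ω
  · refine Or.inl ⟨hyΩ, ?_⟩
    filter_upwards [hΩ.mem_nhds hyΩ] with z hz
    exact indicator_of_mem hz ψ
  · refine Or.inr ⟨hyΩ, ?_⟩
    by_cases hyc : y ∈ closure Ω
    · have hyf : y ∈ frontier Ω := by
        rw [hΩ.frontier_eq]
        exact ⟨hyc, hyΩ⟩
      have hyt : y ∉ tsupport ψ := fun h => hy ⟨hyf, h⟩
      filter_upwards [notMem_tsupport_iff_eventuallyEq.1 hyt] with z hz
      by_cases hzΩ : z ∈ Ω
      · rw [indicator_of_mem hzΩ, hz]; rfl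
      · exact indicator_of_notMem hzΩ ψ
    · filter_upwards [isClosed_closure.isOpen_compl.mem_nhds hyc] with z hz
      exact indicator_of_notMem (fun h => hz (subset_closure h)) ψ

lemma contDiffAt_indicator (hΩ : IsOpen Ω) (hψ : ContDiff ℝ ∞ ψ) {y : Sp n}
    (hy : y ∉ frontier Ω ∩ tsupport ψ) : ContDiffAt ℝ ∞ (Ω.indicator ψ) y := by
  rcases indicator_eventuallyEq hΩ hy with ⟨-, h⟩ | ⟨-, h⟩
  · exact hψ.contDiffAt.congr_of_eventuallyEq h
  · exact contDiffAt_const.congr_of_eventuallyEq h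

lemma fderiv_indicator_eq (hΩ : IsOpen Ω) {y : Sp n} (hy : y ∉ frontier Ω ∩ tsupport ψ) :
    fderiv ℝ (Ω.indicator ψ) y = Ω.indicator (fderiv ℝ ψ) y := by
  rcases indicator_eventuallyEq hΩ hy with ⟨h0, h⟩ | ⟨h0, h⟩
  · rw [h.fderiv_eq, indicator_of_mem h0]
  · rw [h.fderiv_eq, indicator_of_notMem h0, fderiv_fun_const]; rfl

/-- The extension is smooth along a segment avoiding the jump set, so the fundamental theorem of
calculus and Cauchy–Schwarz apply. -/
lemma enorm_sub_sq_le_lintegral_segment (hΩ : IsOpen Ω) (hψ : ContDiff ℝ ∞ ψ) {x h : Sp n}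
    (hseg : ∀ t ∈ Icc (0 : ℝ) 1, x + t • h ∉ frontier Ω ∩ tsupport ψ) :
    ‖Ω.indicator ψ (x + h) - Ω.indicator ψ x‖ₑ ^ 2 ≤
      ‖h‖ₑ ^ 2 * ∫⁻ t in Icc (0 : ℝ) 1, ‖Ω.indicator (fderiv ℝ ψ) (x + t • h)‖ₑ ^ 2 := by
  set v := Ω.indicator ψ
  have hd : ∀ t ∈ Icc (0 : ℝ) 1, HasDerivAt (fun t : ℝ => v (x + t • h))
      (fderiv ℝ v (x + t • h) h) t := by
    intro t ht
    have h1 : HasFDerivAt v (fderiv ℝ v (x + t • h)) (x + t • h) :=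
      ((contDiffAt_indicator hΩ hψ (hseg t ht)).differentiableAt (by simp)).hasFDerivAt
    have h2 : HasDerivAt (fun t : ℝ => x + t • h) h t := by
      simpa using ((hasDerivAt_id t).smul_const h).const_add x
    exact h1.comp_hasDerivAt t h2
  have hcont : ContinuousOn (fun t : ℝ => fderiv ℝ v (x + t • h) h) (Icc 0 1) := by
    intro t ht
    refine ContinuousAt.continuousWithinAt ?_
    have h1 : ContinuousAt (fderiv ℝ v) (x + t • h) :=
      ((contDiffAt_indicator hΩ hψ (hseg t ht)).fderiv_right (m := 0) (by simp)).continuousAt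
    have h2 : ContinuousAt (fun t : ℝ => x + t • h) t := by fun_prop
    exact (ContinuousAt.comp (f := fun t : ℝ => x + t • h) h1 h2).clm_apply continuousAt_const
  have hint : IntervalIntegrable (fun t : ℝ => fderiv ℝ v (x + t • h) h) volume 0 1 := by
    apply ContinuousOn.intervalIntegrable
    rwa [uIcc_of_le zero_le_one]
  have hftc := intervalIntegral.integral_eq_sub_of_hasDerivAt
    (f := fun t : ℝ => v (x + t • h)) (a := 0) (b := 1)
    (fun t ht => hd t (by rwa [uIcc_of_le zero_le_one] at ht)) hint
  simp only [one_smul, zero_smul, add_zero] at hftc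
  rw [← hftc, intervalIntegral.integral_of_le zero_le_one, ← integral_Icc_eq_integral_Ioc]
  have hmeas : Measurable fun t : ℝ => ‖Ω.indicator (fderiv ℝ ψ) (x + t • h)‖ₑ := by
    have : Measurable (Ω.indicator (fderiv ℝ ψ)) :=
      (hψ.continuous_fderiv (by simp)).measurable.indicator hΩ.measurableSet
    exact (this.comp (by fun_prop)).enorm
  calc ‖∫ t in Icc (0 : ℝ) 1, fderiv ℝ v (x + t • h) h‖ₑ ^ 2
      ≤ (∫⁻ t in Icc (0 : ℝ) 1, ‖fderiv ℝ v (x + t • h) h‖ₑ) ^ 2 := by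
        gcongr; exact enorm_integral_le_lintegral_enorm _
    _ ≤ (∫⁻ t in Icc (0 : ℝ) 1, ‖h‖ₑ * ‖Ω.indicator (fderiv ℝ ψ) (x + t • h)‖ₑ) ^ 2 := by
        gcongr ?_ ^ 2
        refine setLIntegral_mono' measurableSet_Icc fun t ht => ?_
        rw [fderiv_indicator_eq hΩ (hseg t ht), mul_comm]
        exact ContinuousLinearMap.le_opENorm _ _
    _ ≤ ‖h‖ₑ ^ 2 * ∫⁻ t in Icc (0 : ℝ) 1, ‖Ω.indicator (fderiv ℝ ψ) (x + t • h)‖ₑ ^ 2 := by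
        rw [lintegral_const_mul _ hmeas, mul_pow]
        gcongr
        refine (sq_lintegral_le _ hmeas.aemeasurable).trans ?_
        simp

/-- The segment estimate is integrated over `x`; Tonelli and translation invariance make every `t`
contribute the same. Segments start in `Ω` but may leave it, where the extension vanishes. -/
lemma lintegral_translate_sub_sq_le (hΩ : IsOpen Ω) (hψ : ContDiff ℝ ∞ ψ) {h : Sp n}
    (hseg : ∀ x ∈ Ω, ∀ t ∈ Icc (0 : ℝ) 1, x + t • h ∉ frontier Ω ∩ tsupport ψ) :
    ∫⁻ x in Ω, ‖Ω.indicator ψ (x + h) - Ω.indicator ψ x‖ₑ ^ 2 ≤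
      ‖h‖ₑ ^ 2 * ∫⁻ y in Ω, ‖fderiv ℝ ψ y‖ₑ ^ 2 := by
  set G : Sp n → ENNReal := fun y => ‖Ω.indicator (fderiv ℝ ψ) y‖ₑ ^ 2 with hG
  have hGm : Measurable G :=
    (((hψ.continuous_fderiv (by simp)).measurable.indicator hΩ.measurableSet).enorm).pow_const 2
  have hGint : ∫⁻ y, G y = ∫⁻ y in Ω, ‖fderiv ℝ ψ y‖ₑ ^ 2 := by
    rw [← lintegral_indicator hΩ.measurableSet]
    refine lintegral_congr fun y => ?_
    by_cases hy : y ∈ Ω <;> simp [hG, hy, ← ofReal_norm]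
  have hjoint : Measurable (Function.uncurry fun (x : Sp n) (t : ℝ) => G (x + t • h)) :=
    hGm.comp (by fun_prop)
  calc ∫⁻ x in Ω, ‖Ω.indicator ψ (x + h) - Ω.indicator ψ x‖ₑ ^ 2
      ≤ ∫⁻ x in Ω, ‖h‖ₑ ^ 2 * ∫⁻ t in Icc (0 : ℝ) 1, G (x + t • h) :=
        setLIntegral_mono' hΩ.measurableSet fun x hx =>
          enorm_sub_sq_le_lintegral_segment hΩ hψ (hseg x hx)
    _ ≤ ∫⁻ x, ‖h‖ₑ ^ 2 * ∫⁻ t in Icc (0 : ℝ) 1, G (x + t • h) := setLIntegral_le_lintegral _ _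
    _ = ‖h‖ₑ ^ 2 * ∫⁻ x, ∫⁻ t in Icc (0 : ℝ) 1, G (x + t • h) :=
        lintegral_const_mul _ hjoint.lintegral_prod_right
    _ = ‖h‖ₑ ^ 2 * ∫⁻ t in Icc (0 : ℝ) 1, ∫⁻ x, G (x + t • h) := by
        rw [lintegral_lintegral_swap hjoint.aemeasurable]
    _ = ‖h‖ₑ ^ 2 * ∫⁻ y in Ω, ‖fderiv ℝ ψ y‖ₑ ^ 2 := by
        simp only [lintegral_add_right_eq_self G, hGint]
        simp

/-- The integral of `f` over `Ω ∩ B(x, s)`. -/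
def ballIntegral (Ω : Set (Sp n)) (s : ℝ) (f : Sp n → ℝ) (x : Sp n) : ℝ :=
  ∫ y in Metric.ball x s, f y ∂(volume.restrict Ω)

lemma ballIntegral_congr_ae {s : ℝ} {f g : Sp n → ℝ} (h : f =ᵐ[volume.restrict Ω] g) (x : Sp n) :
    ballIntegral Ω s f x = ballIntegral Ω s g x :=
  integral_congr_ae (ae_restrict_of_ae h)

lemma ballIntegral_eq_setIntegral (hΩ : IsOpen Ω) (s : ℝ) (c x : Sp n) :
    ∫ h in Metric.ball c s, Ω.indicator ψ (x + h) = ballIntegral Ω s ψ (x + c) := by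
  rw [ballIntegral, Measure.restrict_restrict Metric.isOpen_ball.measurableSet,
    ← integral_indicator Metric.isOpen_ball.measurableSet,
    ← integral_indicator (Metric.isOpen_ball.measurableSet.inter hΩ.measurableSet),
    ← integral_add_left_eq_self ((Metric.ball (x + c) s ∩ Ω).indicator ψ) x]
  refine integral_congr_ae (Eventually.of_forall fun h => ?_)
  have : x + h ∈ Metric.ball (x + c) s ↔ h ∈ Metric.ball c s := by simp [Metric.mem_ball]
  by_cases h1 : h ∈ Metric.ball c s <;> by_cases h2 : x + h ∈ Ω <;>
    simp [indicator, h1, h2, this]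

/-- A Poincaré-type inequality: up to a small multiple of the gradient, the `L²` norm is
controlled by local averages. -/
lemma lintegral_sq_le_ballIntegral (hΩ : IsOpen Ω) {U : Set (Sp n)} (hψ : IsTest U ψ) {c : Sp n}
    {s δ : ℝ} (hadm : ∀ h ∈ Metric.ball c s, ‖h‖ ≤ δ ∧
      ∀ x ∈ Ω, ∀ t ∈ Icc (0 : ℝ) 1, x + t • h ∉ frontier Ω ∩ U) :
    volume (Metric.ball c s) ^ 2 * ∫⁻ x in Ω, ‖ψ x‖ₑ ^ 2 ≤
      2 * (∫⁻ x in Ω, ‖ballIntegral Ω s ψ (x + c)‖ₑ ^ 2) +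
      2 * (volume (Metric.ball c s) ^ 2 * (ENNReal.ofReal δ ^ 2 *
        ∫⁻ y in Ω, ‖fderiv ℝ ψ y‖ₑ ^ 2)) := by
  set D := Metric.ball c s
  set v := Ω.indicator ψ with hv
  have hDfin : volume D ≠ ⊤ := measure_ball_lt_top.ne
  have hvm : Measurable v := hψ.1.continuous.measurable.indicator hΩ.measurableSet
  have hjoint : Measurable (Function.uncurry fun (x h : Sp n) => ‖v (x + h) - v x‖ₑ ^ 2) :=
    ((((hvm.comp (by fun_prop)).sub (hvm.comp measurable_fst)).enorm).pow_const 2 :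
      Measurable fun p : Sp n × Sp n => ‖v (p.1 + p.2) - v p.1‖ₑ ^ 2)
  obtain ⟨M, hM⟩ := hψ.2.1.exists_bound_of_continuous hψ.1.continuous
  have hvM : ∀ y, ‖v y‖ ≤ M := fun y => (norm_indicator_le_norm_self ψ y).trans (hM y)
  -- Integrating `v x = v (x + h) - (v (x + h) - v x)` over `h ∈ D` gives a local average minus an
  -- integral of increments.
  have hpt : ∀ x ∈ Ω, volume D ^ 2 * ‖ψ x‖ₑ ^ 2 ≤ 2 * ‖ballIntegral Ω s ψ (x + c)‖ₑ ^ 2 +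
      2 * (volume D * ∫⁻ h in D, ‖v (x + h) - v x‖ₑ ^ 2) := by
    intro x hx
    have hi1 : IntegrableOn (fun h => v (x + h)) D :=
      Measure.integrableOn_of_bounded hDfin (hvm.comp (by fun_prop)).aestronglyMeasurable
        (Eventually.of_forall fun h => hvM _)
    have hi2 : IntegrableOn (fun _ => v x) D := integrableOn_const hDfin
    have h1 : volume.real D * ψ x = ballIntegral Ω s ψ (x + c) - ∫ h in D, (v (x + h) - v x) := by
      rw [integral_sub hi1 hi2, hv, ballIntegral_eq_setIntegral hΩ, setIntegral_const,
        indicator_of_mem hx, smul_eq_mul]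
      ring
    have h2 : volume D * ‖ψ x‖ₑ ≤
        ‖ballIntegral Ω s ψ (x + c)‖ₑ + ∫⁻ h in D, ‖v (x + h) - v x‖ₑ := by
      have h3 : volume D * ‖ψ x‖ₑ = ‖volume.real D * ψ x‖ₑ := by
        rw [enorm_mul, Real.enorm_of_nonneg measureReal_nonneg, measureReal_def,
          ENNReal.ofReal_toReal hDfin]
      rw [h3, h1]
      refine (enorm_sub_le).trans ?_
      gcongr
      exact enorm_integral_le_lintegral_enorm _
    have hmx : Measurable fun h => ‖v (x + h) - v x‖ₑ :=
      ((hvm.comp (by fun_prop)).sub measurable_const).enorm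
    rw [← mul_pow]
    calc (volume D * ‖ψ x‖ₑ) ^ 2
        ≤ (‖ballIntegral Ω s ψ (x + c)‖ₑ + ∫⁻ h in D, ‖v (x + h) - v x‖ₑ) ^ 2 := by gcongr
      _ ≤ _ := (add_sq_le_two_mul _ _)
      _ ≤ _ := by
        gcongr
        refine (sq_lintegral_le _ hmx.aemeasurable).trans ?_
        simp
  have hψm : Measurable fun x => ‖ψ x‖ₑ ^ 2 := hψ.1.continuous.measurable.enorm.pow_const 2
  have hin : Measurable fun x => ∫⁻ h in D, ‖v (x + h) - v x‖ₑ ^ 2 := hjoint.lintegral_prod_right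
  calc volume D ^ 2 * ∫⁻ x in Ω, ‖ψ x‖ₑ ^ 2 = ∫⁻ x in Ω, volume D ^ 2 * ‖ψ x‖ₑ ^ 2 :=
        (lintegral_const_mul _ hψm).symm
    _ ≤ ∫⁻ x in Ω, (2 * ‖ballIntegral Ω s ψ (x + c)‖ₑ ^ 2 +
          2 * (volume D * ∫⁻ h in D, ‖v (x + h) - v x‖ₑ ^ 2)) :=
        setLIntegral_mono' hΩ.measurableSet hpt
    _ = 2 * (∫⁻ x in Ω, ‖ballIntegral Ω s ψ (x + c)‖ₑ ^ 2) +
          2 * (volume D * ∫⁻ x in Ω, ∫⁻ h in D, ‖v (x + h) - v x‖ₑ ^ 2) := by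
        rw [lintegral_add_right _ ((hin.const_mul _).const_mul _),
          lintegral_const_mul' _ _ (by simp), lintegral_const_mul' _ _ (by simp),
          lintegral_const_mul' _ _ hDfin]
    _ ≤ _ := by
        rw [lintegral_lintegral_swap hjoint.aemeasurable, sq (volume D), mul_assoc]
        gcongr
        calc ∫⁻ h in D, ∫⁻ x in Ω, ‖v (x + h) - v x‖ₑ ^ 2
            ≤ ∫⁻ h in D, ENNReal.ofReal δ ^ 2 * ∫⁻ y in Ω, ‖fderiv ℝ ψ y‖ₑ ^ 2 := by
              refine setLIntegral_mono' Metric.isOpen_ball.measurableSet fun h hh => ?_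
              refine (lintegral_translate_sub_sq_le hΩ hψ.1 fun x hx t ht hc =>
                (hadm h hh).2 x hx t ht ⟨hc.1, hψ.2.2 hc.2⟩).trans ?_
              gcongr
              rw [← ofReal_norm]
              exact ENNReal.ofReal_le_ofReal (hadm h hh).1
          _ = _ := by simp [mul_comm]

end Translation

/-! ### Upward directions at a Lipschitz graph. -/

section Cone

variable {n : ℕ} {Ω : Set (Sp n)}

/-- There are arbitrarily short open sets of directions along which no segment starting in `Ω`
meets the boundary inside `U`. -/
def HasInwardDirections (Ω U : Set (Sp n)) : Prop :=
  ∀ δ > 0, ∃ c : Sp n, ∃ s > 0, ∀ h ∈ Metric.ball c s, ‖h‖ ≤ δ ∧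
    ∀ x ∈ Ω, ∀ t ∈ Icc (0 : ℝ) 1, x + t • h ∉ frontier Ω ∩ U

lemma norm_sq_eq_firstCoords (x : Sp n) : ‖x‖ ^ 2 = ‖firstCoords x‖ ^ 2 + lastCoord x ^ 2 := by
  simp [EuclideanSpace.norm_sq_eq, Fin.sum_univ_castSucc, firstCoords, lastCoord]

lemma norm_firstCoords_le (x : Sp n) : ‖firstCoords x‖ ≤ ‖x‖ := by
  refine (pow_le_pow_iff_left₀ (norm_nonneg _) (norm_nonneg _) two_ne_zero).1 ?_
  rw [norm_sq_eq_firstCoords]; nlinarith [sq_nonneg (lastCoord x)]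

lemma abs_lastCoord_le (x : Sp n) : |lastCoord x| ≤ ‖x‖ := by
  refine (pow_le_pow_iff_left₀ (abs_nonneg _) (norm_nonneg _) two_ne_zero).1 ?_
  rw [norm_sq_eq_firstCoords, sq_abs]; nlinarith [sq_nonneg ‖firstCoords x‖]

lemma firstCoords_add_smul (x y : Sp n) (t : ℝ) :
    firstCoords (x + t • y) = firstCoords x + t • firstCoords y := by
  ext j; simp [firstCoords]

lemma lastCoord_add_smul (x y : Sp n) (t : ℝ) :
    lastCoord (x + t • y) = lastCoord x + t * lastCoord y := by
  simp [lastCoord]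

lemma IsC11NearOrigin.hasInwardDirections {r : ℝ} (hr : 0 < r) (hΩ : IsC11NearOrigin Ω r)
    {U : Set (Sp n)} (hU : frontier Ω ∩ U ⊆ Metric.ball 0 (r / 2)) : HasInwardDirections Ω U := by
  obtain ⟨g, hg, ⟨K, hK⟩, hΩr, hfr⟩ := hΩ
  -- A bound for the gradient of `g` on `B_r`, hence a Lipschitz constant there.
  set L : ℝ := ‖fderiv ℝ g 0‖ + K * r with hL
  have hL0 : 0 ≤ L := by positivity
  have hlip : ∀ a ∈ Metric.ball (0 : EuclideanSpace ℝ (Fin n)) r,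
      ∀ b ∈ Metric.ball (0 : EuclideanSpace ℝ (Fin n)) r, ‖g b - g a‖ ≤ L * ‖b - a‖ := by
    intro a ha b hb
    refine (convex_ball 0 r).norm_image_sub_le_of_norm_fderiv_le
      (fun x _ => hg.differentiable one_ne_zero x) (fun x hx => ?_) ha hb
    have h1 : ‖fderiv ℝ g x - fderiv ℝ g 0‖ ≤ K * ‖x - 0‖ := hK.norm_sub_le x 0
    have h2 : ‖fderiv ℝ g x‖ ≤ ‖fderiv ℝ g 0‖ + ‖fderiv ℝ g x - fderiv ℝ g 0‖ := by
      have := norm_add_le (fderiv ℝ g 0) (fderiv ℝ g x - fderiv ℝ g 0)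
      rwa [add_sub_cancel] at this
    have h3 : ‖x‖ < r := by simpa using hx
    rw [sub_zero] at h1
    have h4 : (K : ℝ) * ‖x‖ ≤ K * r := by gcongr
    linarith
  intro δ hδ
  -- Every `h` in the ball of radius `s` about height `(L + 2) s` has norm at most `(L + 3) s`,
  -- horizontal part at most `s` and vertical part at least `(L + 1) s`, so it climbs faster than
  -- the graph. The bound `r / 4` keeps in `B_r` the start of any segment reaching `B_{r/2}`.
  set s : ℝ := min δ (r / 4) / (L + 3) with hs
  have hm : 0 < min δ (r / 4) := lt_min hδ (by positivity)
  have hs0 : 0 < s := by positivity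
  have hsL : (L + 3) * s = min δ (r / 4) := by
    rw [hs]; field_simp
  set e : Sp n := EuclideanSpace.single (Fin.last n) 1 with he
  have he1 : ‖e‖ = 1 := by simp [he]
  have hef : firstCoords e = 0 := by
    ext j; simp [firstCoords, he]
  have hel : lastCoord e = 1 := by simp [lastCoord, he]
  refine ⟨((L + 2) * s) • e, s, hs0, fun h hh => ?_⟩
  rw [mem_ball_iff_norm] at hh
  set d := h - ((L + 2) * s) • e with hd
  have hhd : h = d + ((L + 2) * s) • e := by rw [hd, sub_add_cancel]
  have hnorm : ‖h‖ ≤ min δ (r / 4) := by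
    rw [← hsL, hhd]
    refine (norm_add_le _ _).trans ?_
    rw [norm_smul, he1, Real.norm_of_nonneg (by positivity)]
    linarith
  have hfirst : ‖firstCoords h‖ ≤ s := by
    rw [hhd, firstCoords_add_smul, hef, smul_zero, add_zero]
    exact (norm_firstCoords_le d).trans hh.le
  have hlast : (L + 1) * s ≤ lastCoord h := by
    rw [hhd, lastCoord_add_smul, hel]
    have := (abs_le.1 ((abs_lastCoord_le d).trans hh.le)).1
    linarith
  refine ⟨hnorm.trans (min_le_left _ _), fun x hx t ht hy => ?_⟩
  have hyball := hU hy
  rw [mem_ball_zero_iff] at hyball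
  have hth : ‖t • h‖ ≤ r / 4 := by
    rw [norm_smul, Real.norm_of_nonneg ht.1]
    have := hnorm.trans (min_le_right _ _)
    nlinarith [norm_nonneg h, ht.2]
  have hxn : ‖x‖ < r := by
    have : x = (x + t • h) - t • h := by abel
    rw [this]
    refine (norm_sub_le _ _).trans_lt ?_
    linarith
  have hyn : ‖x + t • h‖ < r := by linarith
  have h1 : g (firstCoords x) < lastCoord x := by
    have : x ∈ Metric.ball 0 r ∩ Ω := ⟨by simpa using hxn, hx⟩
    rw [hΩr] at this
    exact this.2
  have h2 : lastCoord (x + t • h) = g (firstCoords (x + t • h)) := by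
    have : x + t • h ∈ Metric.ball 0 r ∩ frontier Ω := ⟨by simpa using hyn, hy.1⟩
    rw [hfr] at this
    exact this.2
  have h3 := hlip (firstCoords x) (by simpa using (norm_firstCoords_le x).trans_lt hxn)
    (firstCoords (x + t • h)) (by simpa using (norm_firstCoords_le _).trans_lt hyn)
  rw [← h2, firstCoords_add_smul, add_sub_cancel_left, norm_smul, Real.norm_of_nonneg ht.1,
    lastCoord_add_smul] at h3
  have h4 := (le_abs_self _).trans h3
  have h5 : L * (t * ‖firstCoords h‖) ≤ t * (L * s) := by
    have : t * (L * ‖firstCoords h‖) ≤ t * (L * s) :=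
      mul_le_mul_of_nonneg_left (mul_le_mul_of_nonneg_left hfirst hL0) ht.1
    linarith
  have h6 : t * ((L + 1) * s) ≤ t * lastCoord h := mul_le_mul_of_nonneg_left hlast ht.1
  have h7 : 0 ≤ t * s := mul_nonneg ht.1 hs0.le
  nlinarith

end Cone

/-! ### Rellich's theorem without global boundary regularity. -/

section Compactness

variable {n : ℕ} {Ω : Set (Sp n)}

/-- As `L²` pairings, local integrals converge pointwise along weakly convergent sequences. -/
lemma ballIntegral_eq_inner {s : ℝ} (f : L2s Ω) (x : Sp n) :
    ballIntegral Ω s f x = inner ℝ f (indicatorConstLp 2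
      (Metric.isOpen_ball (x := x) (ε := s)).measurableSet
      (((Measure.restrict_apply_le _ _).trans_lt measure_ball_lt_top).ne) (1 : ℝ)) := by
  rw [real_inner_comm, L2.inner_indicatorConstLp_one]
  rfl

lemma abs_ballIntegral_le {s : ℝ} (f : L2s Ω) (x : Sp n) :
    |ballIntegral Ω s f x| ≤ ‖f‖ * volume.real (Metric.ball (0 : Sp n) s) ^ (1 / 2 : ℝ) := by
  rw [ballIntegral_eq_inner]
  refine (abs_real_inner_le_norm _ _).trans (mul_le_mul_of_nonneg_left ?_ (norm_nonneg _))
  rw [norm_indicatorConstLp two_ne_zero ENNReal.ofNat_ne_top]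
  simp only [norm_one, one_mul, ENNReal.toReal_ofNat]
  refine Real.rpow_le_rpow measureReal_nonneg ?_ (by norm_num)
  rw [measureReal_def, measureReal_def, ← Measure.addHaar_ball_center volume x s]
  exact ENNReal.toReal_mono measure_ball_lt_top.ne (Measure.restrict_apply_le _ _)

lemma measurable_ballIntegral (s : ℝ) (f : L2s Ω) : Measurable (ballIntegral Ω s f) := by
  have hf : StronglyMeasurable (f : Sp n → ℝ) := Lp.stronglyMeasurable f
  have hS : MeasurableSet {p : Sp n × Sp n | dist p.2 p.1 < s} :=
    (isOpen_lt (by fun_prop) (by fun_prop)).measurableSet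
  have h : StronglyMeasurable fun p : Sp n × Sp n =>
      {p : Sp n × Sp n | dist p.2 p.1 < s}.indicator (fun p => f p.2) p :=
    (hf.comp_measurable measurable_snd).indicator hS
  have h2 := (h.integral_prod_right' (ν := volume.restrict Ω)).measurable
  convert h2 using 2 with x
  rw [ballIntegral, ← integral_indicator Metric.isOpen_ball.measurableSet]
  rfl

lemma test_norm_sq_le (hΩ : IsOpen Ω) {U : Set (Sp n)} {z : H1 Ω}
    (hz : z ∈ testRestrictions Ω U) {c : Sp n} {s δ : ℝ}
    (hadm : ∀ h ∈ Metric.ball c s, ‖h‖ ≤ δ ∧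
      ∀ x ∈ Ω, ∀ t ∈ Icc (0 : ℝ) 1, x + t • h ∉ frontier Ω ∩ U) :
    volume (Metric.ball c s) ^ 2 * ENNReal.ofReal (‖val z‖ ^ 2) ≤
      2 * (∫⁻ x in Ω, ‖ballIntegral Ω s (val z) (x + c)‖ₑ ^ 2) +
      2 * (volume (Metric.ball c s) ^ 2 * (ENNReal.ofReal δ ^ 2 *
        ENNReal.ofReal (‖grad z‖ ^ 2))) := by
  obtain ⟨ψ, hψ, h1, h2⟩ := hz
  have h := lintegral_sq_le_ballIntegral hΩ hψ hadm
  rw [ofReal_norm_sq_Lp, ofReal_norm_sq_Lp]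
  have e1 : ∫⁻ x in Ω, ‖val z x‖ₑ ^ 2 = ∫⁻ x in Ω, ‖ψ x‖ₑ ^ 2 := by
    refine lintegral_congr_ae ?_
    filter_upwards [h1] with x hx
    rw [hx]
  have e2 : ∫⁻ x in Ω, ‖grad z x‖ₑ ^ 2 = ∫⁻ x in Ω, ‖fderiv ℝ ψ x‖ₑ ^ 2 := by
    refine lintegral_congr_ae ?_
    filter_upwards [h2] with x hx
    rw [hx, gradient, ← ofReal_norm, ← ofReal_norm, LinearIsometryEquiv.norm_map]
  rw [e1, e2]
  simp only [ballIntegral_congr_ae h1]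
  exact h

lemma exists_test_approx {U : ℕ → Set (Sp n)} {u : ℕ → H1 Ω}
    (hu : ∀ k, u k ∈ (testRestrictions Ω (U k)).topologicalClosure) :
    ∃ z : ℕ → H1 Ω, (∀ k, z k ∈ testRestrictions Ω (U k)) ∧ ∀ k, ‖z k - u k‖ ≤ 1 / ((k : ℝ) + 1) := by
  have : ∀ k, ∃ z ∈ testRestrictions Ω (U k), ‖z - u k‖ ≤ 1 / ((k : ℝ) + 1) := by
    intro k
    have hk : u k ∈ closure (testRestrictions Ω (U k) : Set (H1 Ω)) := hu k
    obtain ⟨z, hz, hd⟩ := Metric.mem_closure_iff.1 hk (1 / ((k : ℝ) + 1)) (by positivity)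
    refine ⟨z, hz, ?_⟩
    rw [← dist_eq_norm, dist_comm]
    exact hd.le
  choose z hz hzu using this
  exact ⟨z, hz, hzu⟩

lemma tendsto_zero_of_norm_le_inv {E : Type*} [NormedAddCommGroup E] {e : ℕ → E}
    (h : ∀ k, ‖e k‖ ≤ 1 / ((k : ℝ) + 1)) : Tendsto e atTop (𝓝 0) :=
  squeeze_zero_norm h tendsto_one_div_add_atTop_nhds_zero_nat

/-- In the Poincaré-type inequality the gradient term is small by the choice of `δ`; for that fixed
`δ` the local integrals tend to zero pointwise and boundedly on a set of finite measure. -/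
lemma tendsto_val_zero_of_test (hΩ : IsOpen Ω) (hΩb : Bornology.IsBounded Ω) {U : Set (Sp n)}
    (hin : HasInwardDirections Ω U) {z : ℕ → H1 Ω} (hz : ∀ k, z k ∈ testRestrictions Ω U) {C : ℝ}
    (hC : ∀ k, ‖z k‖ ≤ C) (hw : WeakTendsto z 0) :
    Tendsto (fun k => val (z k)) atTop (𝓝 0) := by
  have hC0 : 0 ≤ C := (norm_nonneg _).trans (hC 0)
  have hfin : IsFiniteMeasure (volume.restrict Ω) := ⟨by
    rw [Measure.restrict_apply_univ]; exact hΩb.measure_lt_top⟩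
  suffices h : ∀ η > 0, ∀ᶠ k in atTop, ‖val (z k)‖ ^ 2 ≤ η by
    rw [tendsto_zero_iff_norm_tendsto_zero, Metric.tendsto_nhds]
    intro ε hε
    filter_upwards [h ((ε / 2) ^ 2) (by positivity)] with k hk
    rw [dist_zero_right, norm_norm]
    have := abs_le_of_sq_le_sq hk (by positivity)
    rw [abs_norm] at this
    linarith
  intro η hη
  -- With `δ² C² ≤ η / 4`, the doubled gradient term uses half of `η`; the averages use the other
  -- half.
  set δ : ℝ := Real.sqrt (η / 4) / (C + 1) with hδ
  have hδ0 : 0 < δ := by have := Real.sqrt_pos.2 (show 0 < η / 4 by positivity); positivity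
  have hδC : δ ^ 2 * C ^ 2 ≤ η / 4 := by
    rw [hδ, div_pow, Real.sq_sqrt (by positivity), div_mul_eq_mul_div, div_le_iff₀ (by positivity)]
    have : C ^ 2 ≤ (C + 1) ^ 2 := by nlinarith
    nlinarith
  obtain ⟨c, s, hs, hadm⟩ := hin δ hδ0
  set V := volume (Metric.ball c s)
  have hVfin : V ≠ ⊤ := measure_ball_lt_top.ne
  have hV0 : 0 < V := Metric.measure_ball_pos volume c hs
  set v := V.toReal
  have hv0 : 0 < v := ENNReal.toReal_pos hV0.ne' hVfin
  have hVv : V = ENNReal.ofReal v := (ENNReal.ofReal_toReal hVfin).symm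
  set M : ℝ := C * volume.real (Metric.ball (0 : Sp n) s) ^ (1 / 2 : ℝ)
  have hlim : Tendsto (fun k => ∫⁻ x in Ω, ‖ballIntegral Ω s (val (z k)) (x + c)‖ₑ ^ 2) atTop
      (𝓝 (∫⁻ _ in Ω, 0)) := by
    refine tendsto_lintegral_of_dominated_convergence (fun _ => ENNReal.ofReal M ^ 2)
      (fun k => ?_) (fun k => ?_) ?_ ?_
    · exact (((measurable_ballIntegral s (val (z k))).comp (by fun_prop)).enorm).pow_const 2
    · refine Eventually.of_forall fun x => ?_
      refine pow_le_pow_left' ?_ 2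
      rw [← ofReal_norm, Real.norm_eq_abs]
      refine ENNReal.ofReal_le_ofReal ((abs_ballIntegral_le _ _).trans ?_)
      refine mul_le_mul_of_nonneg_right ((norm_val_le _).trans (hC k)) ?_
      exact Real.rpow_nonneg measureReal_nonneg _
    · rw [lintegral_const]
      exact ENNReal.mul_ne_top (by simp) (measure_ne_top _ _)
    · refine Eventually.of_forall fun x => ?_
      have h1 : Tendsto (fun k => ballIntegral Ω s (val (z k)) (x + c)) atTop (𝓝 0) := by
        simp only [ballIntegral_eq_inner]
        have := hw.val (indicatorConstLp 2
          (Metric.isOpen_ball (x := x + c) (ε := s)).measurableSet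
          (((Measure.restrict_apply_le _ _).trans_lt measure_ball_lt_top).ne) (1 : ℝ))
        have h0 : val (0 : H1 Ω) = 0 := rfl
        rw [h0, inner_zero_left] at this
        exact this
      have h2 := ((ENNReal.continuous_pow 2).tendsto _).comp h1.enorm
      simpa [Function.comp_def] using h2
  rw [lintegral_zero] at hlim
  filter_upwards [hlim.eventually_le_const
    (show (0 : ENNReal) < ENNReal.ofReal (v ^ 2 * (η / 4)) by
      rw [ENNReal.ofReal_pos]; positivity)] with k hk
  have h1 := test_norm_sq_le hΩ (hz k) hadm
  have h2 : V ^ 2 * ENNReal.ofReal (‖val (z k)‖ ^ 2) ≤ 2 * ENNReal.ofReal (v ^ 2 * (η / 4)) +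
      2 * (V ^ 2 * (ENNReal.ofReal δ ^ 2 * ENNReal.ofReal (C ^ 2))) := by
    refine h1.trans ?_
    gcongr
    exact (norm_grad_le _).trans (hC k)
  have hq : 0 ≤ ‖val (z k)‖ ^ 2 := by positivity
  generalize ‖val (z k)‖ ^ 2 = q at h2 hq ⊢
  have two : (2 : ENNReal) = ENNReal.ofReal 2 := by simp
  rw [hVv, two, ← ENNReal.ofReal_pow hv0.le, ← ENNReal.ofReal_pow hδ0.le,
    ← ENNReal.ofReal_mul (by positivity), ← ENNReal.ofReal_mul (by positivity),
    ← ENNReal.ofReal_mul (by positivity), ← ENNReal.ofReal_mul (by positivity),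
    ← ENNReal.ofReal_mul (by positivity), ← ENNReal.ofReal_add (by positivity) (by positivity),
    ENNReal.ofReal_le_ofReal_iff (by positivity)] at h2
  have h3 : v ^ 2 * q ≤ v ^ 2 * η := by
    have : v ^ 2 * (δ ^ 2 * C ^ 2) ≤ v ^ 2 * (η / 4) := by gcongr
    linarith
  exact le_of_mul_le_mul_left h3 (by positivity)

/-- Rellich's theorem for the closure of the test functions on `U`. -/
lemma compactVal_of_hasInwardDirections (hΩ : IsOpen Ω) (hΩb : Bornology.IsBounded Ω)
    {U : Set (Sp n)} (hin : HasInwardDirections Ω U) :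
    CompactVal (testRestrictions Ω U).topologicalClosure := by
  intro u w C hu hC hw
  have hwV : w ∈ (testRestrictions Ω U).topologicalClosure :=
    hw.mem_of_isClosed (Submodule.isClosed_topologicalClosure _) (Eventually.of_forall hu)
  obtain ⟨z, hz, hzu⟩ := exists_test_approx (U := fun _ => U) (u := fun k => u k - w)
    fun k => Submodule.sub_mem _ (hu k) hwV
  have he : Tendsto (fun k => z k - (u k - w)) atTop (𝓝 0) := tendsto_zero_of_norm_le_inv hzu
  have hzw : WeakTendsto z 0 := by
    have := (hw.sub_const w).add_tendsto_zero he
    simpa using this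
  have hzC : ∀ k, ‖z k‖ ≤ 1 + (C + ‖w‖) := by
    intro k
    have h1 : z k = (z k - (u k - w)) + (u k - w) := by abel
    rw [h1]
    refine (norm_add_le _ _).trans (add_le_add ((hzu k).trans ?_)
      ((norm_sub_le _ _).trans (add_le_add (hC k) le_rfl)))
    rw [div_le_one (by positivity)]
    linarith [k.cast_nonneg (α := ℝ)]
  have h1 := tendsto_val_zero_of_test hΩ hΩb hin hz hzC hzw
  have h2 := ((valL Ω).continuous.tendsto 0).comp he
  have h3 := (h1.sub h2).add_const (val w)
  simp only [map_zero, sub_zero, zero_add] at h3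
  refine h3.congr fun k => ?_
  simp only [Function.comp_apply, ← valL_apply, map_sub]
  abel

end Compactness

/-! ### Test functions, uniqueness of gradients, the Dirichlet kernel. -/

section TestFunctions

variable {n : ℕ} {Ω : Set (Sp n)}

lemma IsTest.mono {U U' : Set (Sp n)} {ψ : Sp n → ℝ} (h : IsTest U ψ) (hU : U ⊆ U') :
    IsTest U' ψ :=
  ⟨h.1, h.2.1, h.2.2.trans hU⟩

lemma testRestrictions_mono {U U' : Set (Sp n)} (hU : U ⊆ U') :
    testRestrictions Ω U ≤ testRestrictions Ω U' := by
  rintro w ⟨ψ, hψ, h1, h2⟩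
  exact ⟨ψ, hψ.mono hU, h1, h2⟩

lemma inner_gradient_eq (ψ : Sp n → ℝ) (x v : Sp n) :
    inner ℝ (gradient ψ x) v = fderiv ℝ ψ x v := by
  rw [gradient, InnerProductSpace.toDual_symm_apply]

lemma IsTest.eq_zero_of_notMem {U : Set (Sp n)} {ψ : Sp n → ℝ} (h : IsTest U ψ) {x : Sp n}
    (hx : x ∉ U) : ψ x = 0 :=
  image_eq_zero_of_notMem_tsupport fun h' => hx (h.2.2 h')

lemma IsTest.fderiv_eq_zero_of_notMem {U : Set (Sp n)} {ψ : Sp n → ℝ} (h : IsTest U ψ) {x : Sp n}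
    (hx : x ∉ U) : fderiv ℝ ψ x = 0 := by
  have h1 : x ∉ tsupport ψ := fun h' => hx (h.2.2 h')
  rw [(notMem_tsupport_iff_eventuallyEq.1 h1).fderiv_eq]
  exact fderiv_const_apply 0

/-- The restriction of a test function belongs to `H¹(Ω)`. -/
lemma IsTest.exists_mem_testRestrictions {U : Set (Sp n)} {ψ : Sp n → ℝ} (h : IsTest U ψ) :
    ∃ w ∈ testRestrictions Ω U, val w =ᵐ[volume.restrict Ω] ψ ∧
      grad w =ᵐ[volume.restrict Ω] gradient ψ := by
  have hgc : Continuous (gradient ψ) :=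
    (InnerProductSpace.toDual ℝ (Sp n)).symm.continuous.comp (h.1.continuous_fderiv (by simp))
  have hgs : HasCompactSupport (gradient ψ) :=
    (h.2.1.fderiv (𝕜 := ℝ)).comp_left (map_zero (InnerProductSpace.toDual ℝ (Sp n)).symm)
  have m1 : MemLp ψ 2 (volume.restrict Ω) :=
    (h.1.continuous.memLp_of_hasCompactSupport h.2.1).restrict Ω
  have m2 : MemLp (gradient ψ) 2 (volume.restrict Ω) :=
    (hgc.memLp_of_hasCompactSupport hgs).restrict Ω
  have hw : WithLp.toLp 2 (m1.toLp, m2.toLp) ∈ H1 Ω := by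
    intro χ hχ v
    have e1 : ∫ x in Ω, (m1.toLp : Sp n → ℝ) x * fderiv ℝ χ x v =
        ∫ x, ψ x * fderiv ℝ χ x v := by
      rw [← setIntegral_eq_integral_of_forall_compl_eq_zero (s := Ω)
        (f := fun x => ψ x * fderiv ℝ χ x v)
        (fun x hx => by rw [hχ.fderiv_eq_zero_of_notMem hx]; simp)]
      refine integral_congr_ae ?_
      filter_upwards [m1.coeFn_toLp] with x hx
      rw [hx]
    have e2 : ∫ x in Ω, inner ℝ ((m2.toLp : Sp n → Sp n) x) v * χ x =
        ∫ x, fderiv ℝ ψ x v * χ x := by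
      rw [← setIntegral_eq_integral_of_forall_compl_eq_zero (s := Ω)
        (f := fun x => fderiv ℝ ψ x v * χ x)
        (fun x hx => by rw [hχ.eq_zero_of_notMem hx, mul_zero])]
      refine integral_congr_ae ?_
      filter_upwards [m2.coeFn_toLp] with x hx
      rw [hx, inner_gradient_eq]
    have c1 : Continuous fun x => fderiv ℝ ψ x v :=
      (h.1.continuous_fderiv (by simp)).clm_apply continuous_const
    have c2 : Continuous fun x => fderiv ℝ χ x v :=
      (hχ.1.continuous_fderiv (by simp)).clm_apply continuous_const
    refine e1.trans (Eq.trans ?_ (congrArg Neg.neg e2.symm))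
    refine integral_mul_fderiv_eq_neg_fderiv_mul_of_integrable ?_ ?_ ?_
      (fun x _ => h.1.differentiable (by simp) x) (fun x _ => hχ.1.differentiable (by simp) x)
    · exact (c1.mul hχ.1.continuous).integrable_of_hasCompactSupport hχ.2.1.mul_left
    · exact (h.1.continuous.mul c2).integrable_of_hasCompactSupport h.2.1.mul_right
    · exact (h.1.continuous.mul hχ.1.continuous).integrable_of_hasCompactSupport h.2.1.mul_right
  exact ⟨⟨_, hw⟩, ⟨ψ, h, m1.coeFn_toLp, m2.coeFn_toLp⟩, m1.coeFn_toLp, m2.coeFn_toLp⟩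

/-- A test function supported away from the boundary, cut off outside `Ω`, is a test function
on `Ω`. -/
lemma IsTest.indicator (hΩ : IsOpen Ω) {ψ : Sp n → ℝ} (h : IsTest (frontier Ω)ᶜ ψ) :
    IsTest Ω (Ω.indicator ψ) := by
  have hd : ∀ y, y ∉ frontier Ω ∩ tsupport ψ := fun y hy => h.2.2 hy.2 hy.1
  have hsub : tsupport (Ω.indicator ψ) ⊆ tsupport ψ :=
    closure_mono fun x hx => by
      rw [Function.mem_support] at hx ⊢
      intro h0
      apply hx
      by_cases hxΩ : x ∈ Ω <;> simp [hxΩ, h0]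
  refine ⟨contDiff_iff_contDiffAt.2 fun y => contDiffAt_indicator hΩ h.1 (hd y),
    h.2.1.mono' ((subset_tsupport _).trans hsub), fun y hy => ?_⟩
  rcases indicator_eventuallyEq hΩ (hd y) with ⟨hyΩ, -⟩ | ⟨-, h0⟩
  · exact hyΩ
  · exact (notMem_tsupport_iff_eventuallyEq.2 h0 hy).elim

lemma isFiniteMeasure_restrict_of_isBounded (hΩb : Bornology.IsBounded Ω) :
    IsFiniteMeasure (volume.restrict Ω) :=
  ⟨by rw [Measure.restrict_apply_univ]; exact hΩb.measure_lt_top⟩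

/-- Weak gradients are unique. -/
lemma eq_of_val_eq (hΩ : IsOpen Ω) (hΩb : Bornology.IsBounded Ω) {y w : H1 Ω}
    (h : val y = val w) : y = w := by
  have hfin := isFiniteMeasure_restrict_of_isBounded hΩb
  have hwg : ∀ ψ, IsTest Ω ψ → ∀ v, ∫ x in Ω, inner ℝ (grad y x) v * ψ x =
      ∫ x in Ω, inner ℝ (grad w x) v * ψ x := by
    intro ψ hψ v
    have h1 : ∫ x in Ω, val y x * fderiv ℝ ψ x v = - ∫ x in Ω, inner ℝ (grad y x) v * ψ x :=
      y.2 ψ hψ v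
    have h2 : ∫ x in Ω, val w x * fderiv ℝ ψ x v = - ∫ x in Ω, inner ℝ (grad w x) v * ψ x :=
      w.2 ψ hψ v
    rw [h] at h1
    linarith
  have hcoord : ∀ v : Sp n, ∀ᵐ x ∂volume, x ∈ Ω →
      inner ℝ (grad y x) v - inner ℝ (grad w x) v = 0 := by
    intro v
    have i1 : Integrable (fun x => inner ℝ (grad y x) v) (volume.restrict Ω) :=
      ((Lp.memLp (grad y)).inner_const v).integrable (by norm_num)
    have i2 : Integrable (fun x => inner ℝ (grad w x) v) (volume.restrict Ω) :=
      ((Lp.memLp (grad w)).inner_const v).integrable (by norm_num)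
    refine hΩ.ae_eq_zero_of_integral_contDiff_smul_eq_zero
      (IntegrableOn.locallyIntegrableOn (i1.sub i2)) fun g hg hgc hgs => ?_
    have hgt : IsTest Ω g := ⟨hg, hgc, hgs⟩
    rw [← setIntegral_eq_integral_of_forall_compl_eq_zero (s := Ω)
      (fun x hx => by rw [hgt.eq_zero_of_notMem hx, zero_smul])]
    have h1 := hwg g hgt v
    rw [← sub_eq_zero, ← integral_sub (hgt.integrable_inner_mul _ v)
      (hgt.integrable_inner_mul _ v)] at h1
    rw [← h1]
    refine integral_congr_ae (Eventually.of_forall fun x => ?_)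
    simp only [smul_eq_mul]
    ring
  have hgrad : grad y = grad w := by
    refine Lp.ext ?_
    have hall : ∀ᵐ x ∂volume, ∀ j : Fin (n + 1), x ∈ Ω →
        inner ℝ (grad y x) (EuclideanSpace.single j (1 : ℝ)) -
          inner ℝ (grad w x) (EuclideanSpace.single j (1 : ℝ)) = 0 :=
      ae_all_iff.2 fun j => hcoord _
    rw [EventuallyEq, ae_restrict_iff' hΩ.measurableSet]
    filter_upwards [hall] with x hx hxΩ
    ext j
    have := hx j hxΩ
    simp only [EuclideanSpace.inner_single_right] at this
    simpa [sub_eq_zero] using this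
  refine Subtype.ext ((WithLp.equiv 2 _).injective (Prod.ext h hgrad))

/-- Zero is not a Dirichlet eigenvalue. -/
lemma eigenspace_H10_zero (hΩ : IsOpen Ω) (hΩb : Bornology.IsBounded Ω) :
    eigenspace (H10 Ω) 0 = ⊥ := by
  rw [eq_bot_iff]
  intro φ hφ
  have hgrad : grad φ = 0 := by
    have h1 := hφ.2 φ hφ.1
    rw [zero_mul, energyForm_self] at h1
    exact norm_eq_zero.1 (by nlinarith [norm_nonneg (grad φ)])
  set e : Sp n := EuclideanSpace.single (Fin.last n) 1 with he
  have hlc : ContDiff ℝ ∞ (fun x : Sp n => inner ℝ x e) := contDiff_id.inner ℝ contDiff_const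
  obtain ⟨R, hR⟩ := hΩb.exists_norm_le
  have hq : MemLp (fun x => (val φ x * inner ℝ x e) • e) 2 (volume.restrict Ω) := by
    refine MemLp.of_le_mul (c := R) (Lp.memLp (val φ)) ?_ ?_
    · exact ((Lp.aestronglyMeasurable (val φ)).mul
        hlc.continuous.aestronglyMeasurable).smul_const e
    · rw [ae_restrict_iff' hΩ.measurableSet]
      refine Eventually.of_forall fun x hx => ?_
      have h1 : ‖e‖ = 1 := by simp [he]
      have h2 : ‖(inner ℝ x e : ℝ)‖ ≤ R := by
        refine (norm_inner_le_norm x e).trans ?_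
        rw [h1, mul_one]
        exact hR x hx
      rw [norm_smul, h1, mul_one, norm_mul, mul_comm]
      exact mul_le_mul_of_nonneg_right h2 (norm_nonneg _)
  -- When `∇φ = 0`, testing the weak gradient with `(x · e) ψ` gives `∫ φ ψ = -∫ φ (x · e) ∂_e ψ`.
  -- By density this holds with `φ` in place of `ψ`, where the right side vanishes.
  have htest : ∀ z ∈ testRestrictions Ω Ω, massForm φ z = - inner ℝ (gradL Ω z) hq.toLp := by
    rintro z ⟨ψ, hψ, h1, h2⟩
    have hχ : IsTest Ω (fun x => inner ℝ x e * ψ x) :=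
      ⟨hlc.mul hψ.1, hψ.2.1.mul_left, (tsupport_mul_subset_right).trans hψ.2.2⟩
    have h3 : ∫ x in Ω, val φ x * fderiv ℝ (fun x => inner ℝ x e * ψ x) x e =
        - ∫ x in Ω, inner ℝ (grad φ x) e * (inner ℝ x e * ψ x) := φ.2 _ hχ e
    have h4 : ∫ x in Ω, inner ℝ (grad φ x) e * (inner ℝ x e * ψ x) = 0 := by
      refine integral_eq_zero_of_ae ?_
      rw [hgrad]
      filter_upwards [Lp.coeFn_zero (Sp n) 2 (volume.restrict Ω)] with x hx
      rw [hx]; simp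
    rw [h4, neg_zero] at h3
    have hd : ∀ x, fderiv ℝ (fun x => inner ℝ x e * ψ x) x e =
        ψ x + inner ℝ x e * fderiv ℝ ψ x e := by
      intro x
      have d1 : HasFDerivAt (fun x : Sp n => (inner ℝ x e : ℝ)) (innerSL ℝ e) x := by
        have := (innerSL ℝ e).hasFDerivAt (x := x)
        refine this.congr_of_eventuallyEq (Eventually.of_forall fun y => ?_)
        exact real_inner_comm _ _
      have d2 := (hψ.1.differentiable (by simp) x).hasFDerivAt
      have d3 : HasFDerivAt (fun x => inner ℝ x e * ψ x) _ x := d1.mul d2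
      rw [d3.fderiv]
      have h1 : ‖e‖ = 1 := by simp [he]
      simp [h1]
      ring
    have i1 : Integrable (fun x => val φ x * val z x) (volume.restrict Ω) :=
      (Lp.memLp (val φ)).integrable_mul (q := 2) (Lp.memLp (val z))
    have i2 : Integrable (fun x => inner ℝ (grad z x) ((hq.toLp : Sp n → Sp n) x))
        (volume.restrict Ω) := L2.integrable_inner _ _
    have h5 : massForm φ z + inner ℝ (gradL Ω z) hq.toLp = 0 := by
      rw [massForm, L2.inner_def, gradL_apply, ← integral_add i1 i2, ← h3]
      refine integral_congr_ae ?_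
      filter_upwards [h1, h2, hq.coeFn_toLp] with x a b c
      rw [hd, a, b, c, real_inner_smul_right, inner_gradient_eq]
      ring
    linarith
  have hall : massForm φ φ = - inner ℝ (gradL Ω φ) hq.toLp := by
    have hcl : IsClosed {z : H1 Ω | massForm φ z = - inner ℝ (gradL Ω z) hq.toLp} := by
      simp only [massForm_eq_inner_valL]
      exact isClosed_eq (continuous_const.inner (valL Ω).continuous)
        ((gradL Ω).continuous.inner continuous_const).neg
    exact closure_minimal (s := (testRestrictions Ω Ω : Set (H1 Ω))) htest hcl hφ.1
  rw [gradL_apply, hgrad, inner_zero_left, neg_zero, massForm_self] at hall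
  have hn : ‖φ‖ ^ 2 = 0 := by rw [norm_sq_eq, hall, hgrad]; simp
  exact (Submodule.mem_bot ℝ).2 (norm_eq_zero.1 (by simpa using hn))

end TestFunctions

/-! ### Truncation and cutoff near the origin. -/

section Cutoff

variable {n : ℕ} {Ω : Set (Sp n)}

/-- A smooth bounded truncation, close to the identity for small `ρ`. -/
def truncation (ρ s : ℝ) : ℝ := s / (1 + ρ * s ^ 2)

/-- A bump function equal to `1` on the unit ball and vanishing off the ball of radius `2`. -/
def unitBump (n : ℕ) : ContDiffBump (0 : Sp n) := ⟨1, 2, one_pos, one_lt_two⟩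

/-- A cutoff vanishing on the ball of radius `ρ` and equal to `1` off the ball of radius `2ρ`. -/
def cutoff (n : ℕ) (ρ : ℝ) (x : Sp n) : ℝ := 1 - unitBump n (ρ⁻¹ • x)

variable {ρ : ℝ}

lemma truncation_den_pos (hρ : 0 < ρ) (s : ℝ) : 0 < 1 + ρ * s ^ 2 := by positivity

lemma truncation_sq_le (hρ : 0 < ρ) (s : ℝ) : truncation ρ s ^ 2 ≤ 1 / (4 * ρ) := by
  have h := truncation_den_pos hρ s
  rw [truncation, div_pow, div_le_div_iff₀ (by positivity) (by positivity)]
  nlinarith [sq_nonneg (1 - ρ * s ^ 2)]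

lemma abs_truncation_le (hρ : 0 < ρ) (s : ℝ) : |truncation ρ s| ≤ |s| := by
  have h := truncation_den_pos hρ s
  rw [truncation, abs_div, abs_of_pos h]
  refine div_le_self (abs_nonneg _) ?_
  have : 0 ≤ ρ * s ^ 2 := by positivity
  linarith

lemma hasDerivAt_truncation (hρ : 0 < ρ) (s : ℝ) :
    HasDerivAt (truncation ρ) ((1 - ρ * s ^ 2) / (1 + ρ * s ^ 2) ^ 2) s := by
  have h := truncation_den_pos hρ s
  have h1 : HasDerivAt (fun s : ℝ => 1 + ρ * s ^ 2) (ρ * (2 * s)) s := by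
    simpa using ((hasDerivAt_pow 2 s).const_mul ρ).const_add 1
  have h2 : HasDerivAt (truncation ρ) _ s := (hasDerivAt_id' s).div h1 h.ne'
  have h3 : 1 - ρ * s ^ 2 = 1 * (1 + ρ * s ^ 2) - s * (ρ * (2 * s)) := by ring
  rw [h3]
  exact h2

lemma abs_deriv_truncation_le (hρ : 0 < ρ) (s : ℝ) :
    |(1 - ρ * s ^ 2) / (1 + ρ * s ^ 2) ^ 2| ≤ 1 := by
  have h := truncation_den_pos hρ s
  have h0 : 0 ≤ ρ * s ^ 2 := by positivity
  rw [abs_div, abs_of_pos (pow_pos h 2), div_le_one (pow_pos h 2), abs_le]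
  constructor <;> nlinarith

lemma contDiff_truncation (hρ : 0 < ρ) : ContDiff ℝ ∞ (truncation ρ) := by
  refine contDiff_id.div (by fun_prop) fun s => (truncation_den_pos hρ s).ne'

lemma tendsto_truncation {ρ s : ℕ → ℝ} {a : ℝ} (hρ : Tendsto ρ atTop (𝓝 0))
    (hs : Tendsto s atTop (𝓝 a)) : Tendsto (fun k => truncation (ρ k) (s k)) atTop (𝓝 a) := by
  have h := hs.div ((hρ.mul (hs.pow 2)).const_add 1) (by simp)
  rw [zero_mul, add_zero, div_one] at h
  exact h

lemma contDiff_cutoff (n : ℕ) (ρ : ℝ) : ContDiff ℝ ∞ (cutoff n ρ) :=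
  contDiff_const.sub ((unitBump n).contDiff.comp (contDiff_const_smul ρ⁻¹))

lemma cutoff_mem_Icc (n : ℕ) (ρ : ℝ) (x : Sp n) : cutoff n ρ x ∈ Icc (0 : ℝ) 1 := by
  have h1 := (unitBump n).le_one (x := ρ⁻¹ • x)
  have h2 := (unitBump n).nonneg (x := ρ⁻¹ • x)
  constructor <;> rw [cutoff] <;> linarith

lemma cutoff_eq_zero (hρ : 0 < ρ) {x : Sp n} (hx : ‖x‖ ≤ ρ) : cutoff n ρ x = 0 := by
  rw [cutoff, (unitBump n).one_of_mem_closedBall, sub_self]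
  rw [mem_closedBall_zero_iff, norm_smul, norm_inv, Real.norm_of_nonneg hρ.le]
  exact (inv_mul_le_one₀ hρ).2 hx

lemma cutoff_eq_one (hρ : 0 < ρ) {x : Sp n} (hx : 2 * ρ ≤ ‖x‖) : cutoff n ρ x = 1 := by
  rw [cutoff, (unitBump n).zero_of_le_dist, sub_zero]
  rw [dist_zero_right, norm_smul, norm_inv, Real.norm_of_nonneg hρ.le, inv_mul_eq_div,
    le_div_iff₀ hρ]
  exact hx

/-- Scaling: the gradient is `ρ⁻¹` times that of a fixed bump, evaluated at `ρ⁻¹ x`. -/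
lemma exists_norm_fderiv_cutoff_le (n : ℕ) : ∃ C : ℝ, 0 ≤ C ∧ ∀ ρ > 0, ∀ x : Sp n,
    ‖fderiv ℝ (cutoff n ρ) x‖ ^ 2 ≤ (Metric.closedBall 0 (2 * ρ)).indicator
      (fun _ => C / ρ ^ 2) x := by
  have hc : ContDiff ℝ ∞ (unitBump n) := (unitBump n).contDiff
  obtain ⟨C, hC⟩ := ((unitBump n).hasCompactSupport.fderiv
    (𝕜 := ℝ)).exists_bound_of_continuous (hc.continuous_fderiv (by simp))
  refine ⟨C ^ 2, by positivity, fun ρ hρ x => ?_⟩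
  have hd : fderiv ℝ (cutoff n ρ) x = - (ρ⁻¹ • fderiv ℝ (unitBump n) (ρ⁻¹ • x)) := by
    have h1 : cutoff n ρ = fun x => 1 - unitBump n (ρ⁻¹ • x) := rfl
    rw [h1, fderiv_const_sub, fderiv_comp_smul]
  by_cases hx : x ∈ Metric.closedBall 0 (2 * ρ)
  · rw [indicator_of_mem hx, hd, norm_neg, norm_smul, mul_pow, norm_inv, Real.norm_of_nonneg hρ.le,
      inv_pow, inv_mul_eq_div]
    have := hC (ρ⁻¹ • x)
    gcongr
  · rw [indicator_of_notMem hx, hd]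
    have h2 : ρ⁻¹ • x ∉ tsupport (unitBump n) := by
      have hr : (unitBump n).rOut = 2 := rfl
      rw [(unitBump n).tsupport_eq, hr, mem_closedBall_zero_iff, norm_smul, norm_inv,
        Real.norm_of_nonneg hρ.le, inv_mul_eq_div, div_le_iff₀ hρ]
      simpa using hx
    rw [(notMem_tsupport_iff_eventuallyEq.1 h2).fderiv_eq]
    have h3 : fderiv ℝ (0 : Sp n → ℝ) (ρ⁻¹ • x) = 0 := fderiv_const_apply 0
    rw [h3]; simp

/-- Cutting off a truncated test function near the origin costs a bounded amount of energy in
dimension at least three. -/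
lemma exists_cutoff_bound (hn : 3 ≤ n + 1) (hΩ : IsOpen Ω) : ∃ C : ℝ, 0 ≤ C ∧
    ∀ (U : Set (Sp n)) (z : H1 Ω), z ∈ testRestrictions Ω U → ∀ ρ : ℝ, 0 < ρ → ρ ≤ 1 →
      frontier Ω ∩ U ⊆ Metric.ball 0 ρ → ∃ y ∈ testRestrictions Ω Ω,
        (val y =ᵐ[volume.restrict Ω] fun x => cutoff n ρ x * truncation ρ (val z x)) ∧
        ‖y‖ ^ 2 ≤ 2 * ‖z‖ ^ 2 + C := by
  obtain ⟨A, hA0, hA⟩ := exists_norm_fderiv_cutoff_le n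
  set B := volume.real (Metric.ball (0 : Sp n) 1)
  -- The product of `1 / (4ρ)` for the squared truncation, `A / ρ²` for the cutoff gradient, `ρ³
  -- 2^(n+1) B` for the volume of the ball, and the factor `2` from `(a + b)² ≤ 2a² + 2b²`.
  refine ⟨A / 2 * (2 ^ (n + 1) * B), by positivity, ?_⟩
  rintro U z ⟨ψ, hψ, h1, h2⟩ ρ hρ hρ1 hU
  set θ : Sp n → ℝ := fun x => cutoff n ρ x * truncation ρ (ψ x) with hθ
  have hθ0 : ∀ x, ψ x = 0 → θ x = 0 := fun x hx => by simp [hθ, truncation, hx]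
  have hθs : Function.support θ ⊆ Function.support ψ := fun x hx h0 => hx (hθ0 x h0)
  -- The support of `ψ` meets the boundary only inside `B_ρ`, where the cutoff is zero.
  have hθt : IsTest (frontier Ω)ᶜ θ := by
    refine ⟨(contDiff_cutoff n ρ).mul ((contDiff_truncation hρ).comp hψ.1),
      hψ.2.1.mono hθs, fun x hx hxf => ?_⟩
    have hxU : x ∈ U := hψ.2.2 (closure_mono hθs hx)
    have hxb := hU ⟨hxf, hxU⟩
    have : θ =ᶠ[𝓝 x] 0 := by
      filter_upwards [Metric.isOpen_ball.mem_nhds hxb] with y hy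
      simp [hθ, cutoff_eq_zero hρ (mem_ball_zero_iff.1 hy).le]
    exact notMem_tsupport_iff_eventuallyEq.2 this hx
  obtain ⟨y, hy, hy1, hy2⟩ := (hθt.indicator hΩ).exists_mem_testRestrictions (Ω := Ω)
  have hval : val y =ᵐ[volume.restrict Ω] fun x => cutoff n ρ x * truncation ρ (val z x) := by
    filter_upwards [hy1, h1, ae_restrict_mem hΩ.measurableSet] with x a b hx
    rw [a, b, indicator_of_mem hx]
  refine ⟨y, hy, hval, ?_⟩
  have hvn : ‖val y‖ ^ 2 ≤ ‖val z‖ ^ 2 := by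
    have : ‖val y‖ ≤ ‖val z‖ := by
      refine Lp.norm_le_norm_of_ae_le ?_
      filter_upwards [hval] with x hx
      rw [hx, norm_mul, Real.norm_of_nonneg (cutoff_mem_Icc n ρ x).1]
      calc cutoff n ρ x * ‖truncation ρ (val z x)‖ ≤ 1 * ‖truncation ρ (val z x)‖ :=
            mul_le_mul_of_nonneg_right (cutoff_mem_Icc n ρ x).2 (norm_nonneg _)
        _ ≤ ‖val z x‖ := by rw [one_mul]; exact abs_truncation_le hρ _
    gcongr
  have hpt : ∀ x ∈ Ω, ‖gradient (Ω.indicator θ) x‖ ^ 2 ≤ 2 * ‖gradient ψ x‖ ^ 2 +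
      (Metric.closedBall 0 (2 * ρ)).indicator (fun _ => A / ρ ^ 3 / 2) x := by
    intro x hx
    have hg : ∀ f : Sp n → ℝ, ‖gradient f x‖ = ‖fderiv ℝ f x‖ := fun f => by
      rw [gradient, LinearIsometryEquiv.norm_map]
    rw [hg, hg, fderiv_indicator_eq hΩ fun h => hθt.2.2 h.2 h.1, indicator_of_mem hx]
    have d1 := ((contDiff_cutoff n ρ).differentiable (by simp) x).hasFDerivAt
    have d2 := (hasDerivAt_truncation hρ (ψ x)).comp_hasFDerivAt x
      (hψ.1.differentiable (by simp) x).hasFDerivAt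
    have d3 : HasFDerivAt θ _ x := d1.mul d2
    rw [d3.fderiv]
    have hc := cutoff_mem_Icc n ρ x
    have n1 : ‖cutoff n ρ x • ((1 - ρ * ψ x ^ 2) / (1 + ρ * ψ x ^ 2) ^ 2) • fderiv ℝ ψ x‖ ≤
        ‖fderiv ℝ ψ x‖ := by
      rw [norm_smul, norm_smul, Real.norm_of_nonneg hc.1]
      have := abs_deriv_truncation_le hρ (ψ x)
      calc _ ≤ 1 * (1 * ‖fderiv ℝ ψ x‖) := by
            refine mul_le_mul hc.2 (mul_le_mul_of_nonneg_right this (norm_nonneg _))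
              (by positivity) zero_le_one
        _ = _ := by ring
    have n2 : ‖truncation ρ (ψ x) • fderiv ℝ (cutoff n ρ) x‖ ^ 2 ≤
        (Metric.closedBall 0 (2 * ρ)).indicator (fun _ => A / ρ ^ 3 / 4) x := by
      rw [norm_smul, mul_pow, Real.norm_eq_abs, sq_abs]
      refine (mul_le_mul (truncation_sq_le hρ (ψ x)) (hA ρ hρ x) (by positivity)
        (by positivity)).trans (le_of_eq ?_)
      by_cases hxb : x ∈ Metric.closedBall 0 (2 * ρ)
      · rw [indicator_of_mem hxb, indicator_of_mem hxb]; field_simp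
      · rw [indicator_of_notMem hxb, indicator_of_notMem hxb, mul_zero]
    have n3 : (Metric.closedBall (0 : Sp n) (2 * ρ)).indicator (fun _ => A / ρ ^ 3 / 2) x =
        2 * (Metric.closedBall (0 : Sp n) (2 * ρ)).indicator (fun _ => A / ρ ^ 3 / 4) x := by
      by_cases hxb : x ∈ Metric.closedBall 0 (2 * ρ)
      · rw [indicator_of_mem hxb, indicator_of_mem hxb]; ring
      · rw [indicator_of_notMem hxb, indicator_of_notMem hxb, mul_zero]
    rw [n3]
    have n4 := norm_add_le (cutoff n ρ x • ((1 - ρ * ψ x ^ 2) / (1 + ρ * ψ x ^ 2) ^ 2) •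
      fderiv ℝ ψ x) (truncation ρ (ψ x) • fderiv ℝ (cutoff n ρ) x)
    set a := ‖cutoff n ρ x • ((1 - ρ * ψ x ^ 2) / (1 + ρ * ψ x ^ 2) ^ 2) • fderiv ℝ ψ x‖
    set b := ‖truncation ρ (ψ x) • fderiv ℝ (cutoff n ρ) x‖
    have ha0 : 0 ≤ a := norm_nonneg _
    have hb0 : 0 ≤ b := norm_nonneg _
    calc _ ≤ (a + b) ^ 2 := pow_le_pow_left₀ (norm_nonneg _) n4 2
      _ ≤ 2 * a ^ 2 + 2 * b ^ 2 := by nlinarith [sq_nonneg (a - b)]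
      _ ≤ _ := by
        have := pow_le_pow_left₀ ha0 n1 2
        linarith
  have hvol : volume (Metric.closedBall (0 : Sp n) (2 * ρ)) ≤
      ENNReal.ofReal (ρ ^ 3 * (2 ^ (n + 1) * B)) := by
    rw [Measure.addHaar_closedBall _ _ (by positivity), finrank_euclideanSpace, Fintype.card_fin]
    have hB : volume (Metric.ball (0 : Sp n) 1) = ENNReal.ofReal B :=
      (ENNReal.ofReal_toReal measure_ball_lt_top.ne).symm
    rw [hB, ← ENNReal.ofReal_mul (by positivity)]
    refine ENNReal.ofReal_le_ofReal ?_
    rw [mul_pow]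
    -- This is where the dimension enters: `ρ^N ≤ ρ³` absorbs the factor `ρ⁻³`.
    have := pow_le_pow_of_le_one hρ.le hρ1 hn
    have hB0 : 0 ≤ B := measureReal_nonneg
    calc 2 ^ (n + 1) * ρ ^ (n + 1) * B ≤ 2 ^ (n + 1) * ρ ^ 3 * B := by gcongr
      _ = _ := by ring
  have hgn : ‖grad y‖ ^ 2 ≤ 2 * ‖grad z‖ ^ 2 + A / 2 * (2 ^ (n + 1) * B) := by
    rw [← ENNReal.ofReal_le_ofReal_iff (by positivity), ofReal_norm_sq_Lp,
      ENNReal.ofReal_add (by positivity) (by positivity), ENNReal.ofReal_mul (by norm_num),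
      ofReal_norm_sq_Lp]
    have hm : Measurable ((Metric.closedBall (0 : Sp n) (2 * ρ)).indicator
        fun _ => ENNReal.ofReal (A / ρ ^ 3 / 2)) :=
      measurable_const.indicator Metric.isClosed_closedBall.measurableSet
    calc ∫⁻ x in Ω, ‖grad y x‖ₑ ^ 2
        ≤ ∫⁻ x in Ω, (ENNReal.ofReal 2 * ‖grad z x‖ₑ ^ 2 +
            (Metric.closedBall (0 : Sp n) (2 * ρ)).indicator
              (fun _ => ENNReal.ofReal (A / ρ ^ 3 / 2)) x) := by
          refine lintegral_mono_ae ?_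
          filter_upwards [hy2, h2, ae_restrict_mem hΩ.measurableSet] with x a b hx
          rw [a, b, ← ofReal_norm, ← ofReal_norm, ← ENNReal.ofReal_pow (norm_nonneg _),
            ← ENNReal.ofReal_pow (norm_nonneg _), ← ENNReal.ofReal_mul (by norm_num)]
          have h3 : (Metric.closedBall (0 : Sp n) (2 * ρ)).indicator
              (fun _ => ENNReal.ofReal (A / ρ ^ 3 / 2)) x = ENNReal.ofReal
              ((Metric.closedBall (0 : Sp n) (2 * ρ)).indicator (fun _ => A / ρ ^ 3 / 2) x) := by
            by_cases hxb : x ∈ Metric.closedBall 0 (2 * ρ)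
            · rw [indicator_of_mem hxb, indicator_of_mem hxb]
            · rw [indicator_of_notMem hxb, indicator_of_notMem hxb, ENNReal.ofReal_zero]
          rw [h3, ← ENNReal.ofReal_add (by positivity)
            (indicator_nonneg (fun _ _ => by positivity) _)]
          exact ENNReal.ofReal_le_ofReal (hpt x hx)
      _ = ENNReal.ofReal 2 * (∫⁻ x in Ω, ‖grad z x‖ₑ ^ 2) +
            ∫⁻ x in Ω, (Metric.closedBall (0 : Sp n) (2 * ρ)).indicator
              (fun _ => ENNReal.ofReal (A / ρ ^ 3 / 2)) x := by
          rw [lintegral_add_right _ hm, lintegral_const_mul' _ _ ENNReal.ofReal_ne_top]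
      _ ≤ _ := by
          gcongr
          refine (setLIntegral_le_lintegral _ _).trans ?_
          rw [lintegral_indicator_const Metric.isClosed_closedBall.measurableSet]
          calc _ ≤ ENNReal.ofReal (A / ρ ^ 3 / 2) * ENNReal.ofReal (ρ ^ 3 * (2 ^ (n + 1) * B)) := by
                gcongr
            _ = _ := by
                rw [← ENNReal.ofReal_mul (by positivity)]
                congr 1
                field_simp
  rw [norm_sq_eq, norm_sq_eq]
  have := sq_nonneg ‖val z‖
  linarith

end Cutoff

/-! ### Weak limits satisfy the full Dirichlet condition. -/

section Limit

variable {n : ℕ} {Ω : Set (Sp n)}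

/-- Weak limits of functions vanishing on the boundary outside shrinking neighbourhoods of the
origin belong to `H¹_0(Ω)`, since points have zero capacity. -/
lemma mem_H10_of_weakTendsto (hn : 3 ≤ n + 1) (hΩ : IsOpen Ω) (hΩb : Bornology.IsBounded Ω)
    {W : Submodule ℝ (H1 Ω)} (hc : CompactVal W) (hW : H10 Ω ≤ W) {U : ℕ → Set (Sp n)}
    (hUW : ∀ k, (testRestrictions Ω (U k)).topologicalClosure ≤ W) {ρ : ℕ → ℝ}
    (hρ0 : ∀ k, 0 < ρ k) (hρ1 : ∀ k, ρ k ≤ 1) (hρ : Tendsto ρ atTop (𝓝 0))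
    (hU : ∀ k, frontier Ω ∩ U k ⊆ Metric.ball 0 (ρ k)) {u : ℕ → H1 Ω} {w : H1 Ω} {C : ℝ}
    (hu : ∀ k, u k ∈ (testRestrictions Ω (U k)).topologicalClosure) (hC : ∀ k, ‖u k‖ ≤ C)
    (hw : WeakTendsto u w) : w ∈ H10 Ω := by
  obtain ⟨z, hz, hzu⟩ := exists_test_approx hu
  have hval := hc u w C (fun k => hUW k (hu k)) hC hw
  have hzval : Tendsto (fun k => val (z k)) atTop (𝓝 (val w)) := by
    have h1 := ((valL Ω).continuous.tendsto 0).comp (tendsto_zero_of_norm_le_inv hzu)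
    have h2 := h1.add hval
    rw [map_zero, zero_add] at h2
    refine h2.congr fun k => ?_
    simp only [Function.comp_apply, ← valL_apply, map_sub, sub_add_cancel]
  have hzC : ∀ k, ‖z k‖ ≤ 1 + C := by
    intro k
    have h1 : z k = (z k - u k) + u k := by abel
    rw [h1]
    refine (norm_add_le _ _).trans (add_le_add ((hzu k).trans ?_) (hC k))
    rw [div_le_one (by positivity)]
    linarith [k.cast_nonneg (α := ℝ)]
  obtain ⟨A, hA0, hA⟩ := exists_cutoff_bound hn hΩ
  choose y hy hyval hynorm using fun k =>
    hA (U k) (z k) (hz k) (ρ k) (hρ0 k) (hρ1 k) (hU k)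
  have hyH : ∀ k, y k ∈ H10 Ω := fun k => Submodule.le_topologicalClosure _ (hy k)
  have hyC : ∀ k, ‖y k‖ ≤ 1 + (2 * (1 + C) ^ 2 + A) := by
    intro k
    have h1 := pow_le_pow_left₀ (norm_nonneg _) (hzC k) 2
    nlinarith [hynorm k, sq_nonneg (‖y k‖ - 1)]
  obtain ⟨q, s, hs, hq⟩ := exists_weakTendsto_subseq hyC
  have hqH : q ∈ H10 Ω := hq.mem_of_isClosed (Submodule.isClosed_topologicalClosure _)
    (Eventually.of_forall fun k => hyH (s k))
  have hqval := hc _ q _ (fun k => hW (hyH (s k))) (fun k => hyC (s k)) hq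
  obtain ⟨a, ha, hae⟩ := (tendstoInMeasure_of_tendsto_Lp hqval).exists_seq_tendsto_ae
  have hz' : Tendsto (fun k => val (z (s (a k)))) atTop (𝓝 (val w)) :=
    hzval.comp (hs.tendsto_atTop.comp ha.tendsto_atTop)
  obtain ⟨b, hb, hbe⟩ := (tendstoInMeasure_of_tendsto_Lp hz').exists_seq_tendsto_ae
  have hne : ∀ᵐ x ∂volume.restrict Ω, x ≠ 0 := by
    refine ae_restrict_of_ae ?_
    rw [ae_iff]
    simp
  -- Along a common subsequence both `L²` limits are almost everywhere limits. At `x ≠ 0` the cutoff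
  -- is eventually `1` and the truncation tends to the identity, so they agree.
  have heq : val q = val w := by
    refine Lp.ext ?_
    filter_upwards [hae, hbe, ae_all_iff.2 hyval, hne] with x h1 h2 h3 h4
    have hidx : Tendsto (fun k => s (a (b k))) atTop atTop :=
      hs.tendsto_atTop.comp (ha.tendsto_atTop.comp hb.tendsto_atTop)
    have h5 : Tendsto (fun k => val (y (s (a (b k)))) x) atTop (𝓝 (val q x)) :=
      h1.comp hb.tendsto_atTop
    refine tendsto_nhds_unique h5 ?_
    have h6 := tendsto_truncation (hρ.comp hidx) h2
    refine h6.congr' ?_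
    have h7 : ∀ᶠ k in atTop, ρ (s (a (b k))) < ‖x‖ / 2 :=
      (hρ.comp hidx).eventually_lt_const (by have := norm_pos_iff.2 h4; positivity)
    filter_upwards [h7] with k hk
    rw [h3, cutoff_eq_one (hρ0 _) (by linarith), one_mul]
    rfl
  rw [← eq_of_val_eq hΩ hΩb heq]
  exact hqH

end Limit

/-! ### Convergence of eigenvalues and eigenfunctions. -/

section Eigenvalues

variable {n : ℕ} {Ω : Set (Sp n)}

/-- The set of levels below which there are at least `i` eigenvalues. -/
def eigenLevels (V : Submodule ℝ (H1 Ω)) (i : ℕ) : Set ℝ :=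
  {t : ℝ | (i : Cardinal) ≤ Module.rank ℝ (lowSpace V t)}

lemma nthEigenvalue_eq (V : Submodule ℝ (H1 Ω)) (i : ℕ) :
    nthEigenvalue V i = sInf (eigenLevels V i) := rfl

lemma nonneg_of_mem_eigenLevels {V : Submodule ℝ (H1 Ω)} {i : ℕ} (hi : 1 ≤ i) {t : ℝ}
    (ht : t ∈ eigenLevels V i) : 0 ≤ t := by
  obtain ⟨u, -, ho, hl⟩ := hasLowFamily_of_le_rank ht
  have h1 := hl (Pi.single ⟨0, hi⟩ 1)
  have h2 : ∑ l, (Pi.single ⟨0, hi⟩ 1 : Fin i → ℝ) l • u l = u ⟨0, hi⟩ := by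
    rw [Finset.sum_eq_single ⟨0, hi⟩] <;> simp +contextual
  have h3 : ‖val (u ⟨0, hi⟩)‖ = 1 := ho.1 _
  have h4 := norm_val_le (u ⟨0, hi⟩)
  rw [h2, h3] at h1
  nlinarith

lemma bddBelow_eigenLevels (V : Submodule ℝ (H1 Ω)) {i : ℕ} (hi : 1 ≤ i) :
    BddBelow (eigenLevels V i) :=
  ⟨0, fun _ ht => nonneg_of_mem_eigenLevels hi ht⟩

lemma nthEigenvalue_nonneg (V : Submodule ℝ (H1 Ω)) {i : ℕ} (hi : 1 ≤ i) :
    0 ≤ nthEigenvalue V i :=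
  Real.sInf_nonneg fun _ ht => nonneg_of_mem_eigenLevels hi ht

lemma mem_eigenLevels_of_lt {V : Submodule ℝ (H1 Ω)} {i : ℕ} (hne : (eigenLevels V i).Nonempty)
    {t : ℝ} (ht : nthEigenvalue V i < t) : t ∈ eigenLevels V i := by
  obtain ⟨s, hs, hst⟩ := exists_lt_of_csInf_lt hne ht
  exact le_trans (show (i : Cardinal) ≤ _ from hs)
    (Submodule.rank_mono (lowSpace_mono V hst.le))

lemma eigenLevels_subset {V W : Submodule ℝ (H1 Ω)} (hVW : V ≤ W)
    (hW : IsClosed (W : Set (H1 Ω))) (hc : CompactVal W) (i : ℕ) :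
    eigenLevels V i ⊆ eigenLevels W i :=
  fun _ ht => le_rank_of_hasLowFamily hW hc ((hasLowFamily_of_le_rank ht).mono hVW)

/-- With no levels the infimum takes its default value `0`, which is not a Dirichlet eigenvalue,
contrary to simplicity. Existence of infinitely many eigenvalues is thus not needed. -/
lemma eigenLevels_H10_nonempty (hΩ : IsOpen Ω) (hΩb : Bornology.IsBounded Ω) {i : ℕ}
    (hsimple : Module.finrank ℝ (eigenspace (H10 Ω) (nthEigenvalue (H10 Ω) i)) = 1) :
    (eigenLevels (H10 Ω) i).Nonempty := by
  by_contra hne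
  rw [not_nonempty_iff_eq_empty] at hne
  rw [nthEigenvalue_eq, hne, Real.sInf_empty, eigenspace_H10_zero hΩ hΩb, finrank_bot] at hsimple
  exact zero_ne_one hsimple

lemma norm_sq_of_mem_eigenspace {V : Submodule ℝ (H1 Ω)} {μ : ℝ} {φ : H1 Ω}
    (hφ : φ ∈ eigenspace V μ) (hn : massForm φ φ = 1) : ‖φ‖ ^ 2 = 1 + μ := by
  rw [← real_inner_self_eq_norm_sq, (mem_eigenspace_iff.1 hφ).2 φ hφ.1, hn, mul_one]

/-- Each `v ∈ V` is admissible in every `Vk k`, so the weak equation passes to the limit for fixed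
`v`. -/
lemma mem_eigenspace_of_tendsto {V W : Submodule ℝ (H1 Ω)} {Vk : ℕ → Submodule ℝ (H1 Ω)}
    (hc : CompactVal W) (hVk : ∀ k, Vk k ≤ W) (hV : ∀ k, V ≤ Vk k) {u : ℕ → H1 Ω} {w : H1 Ω}
    {C : ℝ} (hC : ∀ k, ‖u k‖ ≤ C) (hw : WeakTendsto u w) (hwV : w ∈ V) {μ : ℕ → ℝ} {L : ℝ}
    (hμ : Tendsto μ atTop (𝓝 L)) (hu : ∀ k, u k ∈ eigenspace (Vk k) (μ k)) :
    w ∈ eigenspace V L := by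
  refine mem_eigenspace_iff.2 ⟨hwV, fun v hv => ?_⟩
  have hval := hc u w C (fun k => hVk k (hu k).1) hC hw
  have h1 : Tendsto (fun k => (1 + μ k) * massForm (u k) v) atTop
      (𝓝 ((1 + L) * massForm w v)) := by
    simp only [massForm_eq_inner]
    exact (hμ.const_add 1).mul (hval.inner tendsto_const_nhds)
  refine tendsto_nhds_unique (hw v) (h1.congr fun k => ?_)
  exact ((mem_eigenspace_iff.1 (hu k)).2 v (hV k hv)).symm

lemma eq_of_finrank_eigenspace_eq_one {V : Submodule ℝ (H1 Ω)} {μ : ℝ}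
    (h : Module.finrank ℝ (eigenspace V μ) = 1) {φ w : H1 Ω} (hφ : φ ∈ eigenspace V μ)
    (hφn : massForm φ φ = 1) (hw : w ∈ eigenspace V μ) (hwn : massForm w w = 1)
    (hs : 0 ≤ massForm w φ) : w = φ := by
  have hφ0 : (⟨φ, hφ⟩ : eigenspace V μ) ≠ 0 := by
    intro h0
    have : φ = 0 := congrArg Subtype.val h0
    rw [this, massForm_eq_inner_valL, map_zero, inner_zero_left] at hφn
    exact zero_ne_one hφn
  obtain ⟨c, hc⟩ := (finrank_eq_one_iff_of_nonzero' _ hφ0).1 h ⟨w, hw⟩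
  have hcw : c • φ = w := congrArg Subtype.val hc
  have hmass : ∀ a b : ℝ, massForm (a • φ) (b • φ) = a * b := by
    intro a b
    rw [massForm_eq_inner_valL, map_smul, map_smul, real_inner_smul_left, real_inner_smul_right,
      ← massForm_eq_inner_valL, hφn]
    ring
  have h1 : c * c = 1 := by rw [← hmass, hcw, hwn]
  have h2 : 0 ≤ c := by
    have := hmass c 1
    rw [one_smul, hcw, mul_one] at this
    rwa [this] at hs
  have h3 : c = 1 := by nlinarith
  rw [← hcw, h3, one_smul]

/-- Subsequential convergence of normalized eigenfunctions on subspaces shrinking to `V`. -/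
lemma exists_subseq_tendsto_eigenfunction {V W : Submodule ℝ (H1 Ω)}
    {Vk : ℕ → Submodule ℝ (H1 Ω)} (hVcl : IsClosed (V : Set (H1 Ω)))
    (hVkcl : ∀ k, IsClosed (Vk k : Set (H1 Ω))) (hc : CompactVal W) (hVk : ∀ k, Vk k ≤ W)
    (hV : ∀ k, V ≤ Vk k)
    (hlim : ∀ (s : ℕ → ℕ), StrictMono s → ∀ (u : ℕ → H1 Ω) (w : H1 Ω) (C : ℝ),
      (∀ k, u k ∈ Vk (s k)) → (∀ k, ‖u k‖ ≤ C) → WeakTendsto u w → w ∈ V)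
    {i : ℕ} (hi : 1 ≤ i) (hne : (eigenLevels V i).Nonempty)
    (hsimple : Module.finrank ℝ (eigenspace V (nthEigenvalue V i)) = 1) {φ : H1 Ω}
    (hφ : φ ∈ eigenspace V (nthEigenvalue V i)) (hφn : massForm φ φ = 1) {u : ℕ → H1 Ω}
    (hu : ∀ k, u k ∈ eigenspace (Vk k) (nthEigenvalue (Vk k) i))
    (hun : ∀ k, massForm (u k) (u k) = 1) (hus : ∀ k, 0 ≤ massForm (u k) φ) :
    ∃ s : ℕ → ℕ, StrictMono s ∧ Tendsto (u ∘ s) atTop (𝓝 φ) := by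
  set μ : ℕ → ℝ := fun k => nthEigenvalue (Vk k) i with hμ
  have hVW : V ≤ W := (hV 0).trans (hVk 0)
  have hsub : ∀ k, eigenLevels V i ⊆ eigenLevels (Vk k) i := fun k =>
    eigenLevels_subset (hV k) (hVkcl k) (hc.mono (hVk k)) i
  have hμle : ∀ k, μ k ≤ nthEigenvalue V i := fun k =>
    csInf_le_csInf (bddBelow_eigenLevels _ hi) hne (hsub k)
  have hμ0 : ∀ k, 0 ≤ μ k := fun k => nthEigenvalue_nonneg _ hi
  obtain ⟨L, hL, a, ha, hμL⟩ := isCompact_Icc.tendsto_subseq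
    (fun k => (⟨hμ0 k, hμle k⟩ : μ k ∈ Icc 0 (nthEigenvalue V i)))
  have hfam : HasLowFamily V i L := by
    -- The infimum defining an eigenvalue is not known to be attained here, so levels slightly above
    -- it are used.
    have ht : Tendsto (fun k => μ (a k) + 1 / ((k : ℝ) + 1)) atTop (𝓝 L) := by
      simpa using hμL.add tendsto_one_div_add_atTop_nhds_zero_nat
    refine HasLowFamily.of_tendsto hc (Vk := fun k => Vk (a k)) (fun k => hVk _)
      (fun s hs => hlim (a ∘ s) (ha.comp hs)) ht fun k => ?_
    refine hasLowFamily_of_le_rank (mem_eigenLevels_of_lt (hne.mono (hsub (a k))) ?_)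
    have : (0 : ℝ) < 1 / ((k : ℝ) + 1) := by positivity
    linarith
  -- The limiting family forces `i` eigenvalues on `V` at most `L`, the bound opposite to `hμle`.
  have hLeq : L = nthEigenvalue V i := le_antisymm hL.2
    (csInf_le (bddBelow_eigenLevels _ hi) (le_rank_of_hasLowFamily hVcl (hc.mono hVW) hfam))
  have hnsq : ∀ k, ‖u k‖ ^ 2 = 1 + μ k := fun k => norm_sq_of_mem_eigenspace (hu k) (hun k)
  have hC : ∀ k, ‖u k‖ ≤ 2 + nthEigenvalue V i := fun k => by
    nlinarith [hnsq k, hμle k, sq_nonneg (‖u k‖ - 1)]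
  obtain ⟨w, b, hb, hw⟩ := exists_weakTendsto_subseq (u := u ∘ a) fun k => hC (a k)
  have hμb : Tendsto (fun k => μ (a (b k))) atTop (𝓝 (nthEigenvalue V i)) := by
    rw [← hLeq]; exact hμL.comp hb.tendsto_atTop
  have hwV : w ∈ V := hlim (a ∘ b) (ha.comp hb) _ w _ (fun k => (hu (a (b k))).1)
    (fun k => hC (a (b k))) hw
  have hval := hc _ w _ (fun k => hVk _ (hu (a (b k))).1) (fun k => hC (a (b k))) hw
  have hwE : w ∈ eigenspace V (nthEigenvalue V i) :=
    mem_eigenspace_of_tendsto hc (Vk := fun k => Vk (a (b k))) (fun k => hVk _) (fun k => hV _)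
      (fun k => hC (a (b k))) hw hwV hμb fun k => hu (a (b k))
  have hwn : massForm w w = 1 := by
    rw [massForm_eq_inner]
    refine tendsto_nhds_unique (hval.inner hval) (tendsto_const_nhds.congr fun k => ?_)
    rw [← massForm_eq_inner]
    exact (hun _).symm
  have hws : 0 ≤ massForm w φ := by
    rw [massForm_eq_inner]
    refine ge_of_tendsto' (hval.inner tendsto_const_nhds) fun k => ?_
    rw [← massForm_eq_inner]
    exact hus _
  have hwφ : w = φ := eq_of_finrank_eigenspace_eq_one hsimple hφ hφn hwE hwn hws
  refine ⟨a ∘ b, ha.comp hb, ?_⟩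
  rw [hwφ] at hw
  -- Weak convergence with convergence of norms is strong; the squared norms are `1 + μ`.
  refine hw.tendsto_of_norm_sq ?_
  rw [norm_sq_of_mem_eigenspace hφ hφn]
  refine (hμb.const_add 1).congr fun k => ?_
  exact (hnsq _).symm

end Eigenvalues

end MixedEigen

end

/-! ### Convergence of the mixed eigenfunctions. -/

theorem proposition2p4 {n : ℕ} (hn : 3 ≤ n + 1)
    (Ω : Set (Sp n)) (hΩo : IsOpen Ω) (hΩb : Bornology.IsBounded Ω)
    (h0 : (0 : Sp n) ∈ frontier Ω)
    (r₀ : ℝ) (hr₀ : r₀ ∈ Set.Ioo (0 : ℝ) 1) (hΩr : IsC11NearOrigin Ω r₀)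
    (𝒱 : Set (Sp n)) (h𝒱o : IsOpen 𝒱) (h𝒱b : Bornology.IsBounded 𝒱)
    (h𝒱0 : (0 : Sp n) ∈ 𝒱) (h𝒱d : Metric.diam 𝒱 < r₀)
    (i : ℕ) (hi : 1 ≤ i)
    (hsimple : Module.finrank ℝ (eigenspace (H10 Ω) (nthEigenvalue (H10 Ω) i)) = 1)
    (φ : H1 Ω) (hφ : φ ∈ eigenspace (H10 Ω) (nthEigenvalue (H10 Ω) i))
    (hφn : massForm φ φ = 1)
    (φε : ℝ → H1 Ω)
    (hφε : ∀ ε ∈ Set.Ioo (0 : ℝ) 1,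
      φε ε ∈ eigenspace (mixedSpace Ω 𝒱 ε) (nthEigenvalue (mixedSpace Ω 𝒱 ε) i))
    (hφεn : ∀ ε ∈ Set.Ioo (0 : ℝ) 1, massForm (φε ε) (φε ε) = 1)
    (hsign : ∀ ε ∈ Set.Ioo (0 : ℝ) 1, 0 ≤ massForm (φε ε) φ) :
    Filter.Tendsto φε (nhdsWithin (0 : ℝ) (Set.Ioi 0)) (nhds φ) := by
  have hsmall : ∀ ε > 0, neumannRegion Ω 𝒱 ε ⊆ Metric.ball 0 (ε * r₀) := by
    rintro ε hε x ⟨⟨v, hv, rfl⟩, -⟩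
    have h1 : ‖v‖ < r₀ := by
      rw [← dist_zero_right]
      exact (Metric.dist_le_diam_of_mem h𝒱b hv h𝒱0).trans_lt h𝒱d
    simp only [mem_ball_zero_iff, norm_smul, Real.norm_of_nonneg hε.le]
    exact mul_lt_mul_of_pos_left h1 hε
  have hdisj : ∀ x ∈ Ω, x ∉ frontier Ω := fun x hx hf => by
    rw [hΩo.frontier_eq] at hf
    exact hf.2 hx
  -- Vanishing is required only on the boundary off `B_{r₀/2}`, which yields one compactly embedded
  -- space containing all mixed spaces with `ε < 1/2`.
  set U₀ : Set (Sp n) := (frontier Ω \ Metric.ball 0 (r₀ / 2))ᶜ with hU₀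
  set W : Submodule ℝ (H1 Ω) := (testRestrictions Ω U₀).topologicalClosure
  have hin : HasInwardDirections Ω U₀ := hΩr.hasInwardDirections hr₀.1 fun x hx => by
    by_contra h
    exact hx.2 ⟨hx.1, h⟩
  have hc : CompactVal W := compactVal_of_hasInwardDirections hΩo hΩb hin
  have hHW : H10 Ω ≤ W := Submodule.topologicalClosure_mono
    (testRestrictions_mono fun x hx h => hdisj x hx h.1)
  refine Filter.tendsto_of_subseq_tendsto fun e he => ?_
  have hev : ∀ᶠ k in Filter.atTop, e k ∈ Set.Ioo (0 : ℝ) (1 / 2) :=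
    he.eventually (Ioo_mem_nhdsGT (by norm_num))
  obtain ⟨m, hm⟩ := Filter.eventually_atTop.1 hev
  -- Dropping the first `m` terms makes every parameter smaller than `1/2`; the shift is undone in
  -- the final choice of indices.
  set e' : ℕ → ℝ := fun k => e (k + m) with he'
  have he'm : ∀ k, e' k ∈ Set.Ioo (0 : ℝ) (1 / 2) := fun k => hm _ (Nat.le_add_left m k)
  have he'1 : ∀ k, e' k ∈ Set.Ioo (0 : ℝ) 1 := fun k =>
    ⟨(he'm k).1, (he'm k).2.trans (by norm_num)⟩
  have he'0 : Filter.Tendsto e' Filter.atTop (nhds 0) :=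
    (he.mono_right nhdsWithin_le_nhds).comp (Filter.tendsto_add_atTop_nat m)
  set U : ℕ → Set (Sp n) := fun k => (frontier Ω \ neumannRegion Ω 𝒱 (e' k))ᶜ with hU
  have hUfr : ∀ k, frontier Ω ∩ U k ⊆ Metric.ball 0 (e' k * r₀) := fun k x hx => by
    refine hsmall _ (he'm k).1 ?_
    by_contra h
    exact hx.2 ⟨hx.1, h⟩
  have hUW : ∀ k, (testRestrictions Ω (U k)).topologicalClosure ≤ W := fun k => by
    refine Submodule.topologicalClosure_mono (testRestrictions_mono fun x hx h => ?_)
    refine h.2 (Metric.ball_subset_ball ?_ (hUfr k ⟨h.1, hx⟩))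
    have := (he'm k).2
    nlinarith [hr₀.1]
  have hHU : ∀ k, H10 Ω ≤ mixedSpace Ω 𝒱 (e' k) := fun k =>
    Submodule.topologicalClosure_mono (testRestrictions_mono fun x hx h => hdisj x hx h.1)
  have hρ0 : ∀ k, 0 < e' k * r₀ := fun k => mul_pos (he'm k).1 hr₀.1
  have hρ1 : ∀ k, e' k * r₀ ≤ 1 := fun k => by nlinarith [he'1 k |>.2, hr₀.1, hr₀.2, he'1 k |>.1]
  have hρ : Filter.Tendsto (fun k => e' k * r₀) Filter.atTop (nhds 0) := by
    simpa using he'0.mul_const r₀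
  obtain ⟨s, -, hs⟩ := exists_subseq_tendsto_eigenfunction
    (Vk := fun k => mixedSpace Ω 𝒱 (e' k)) (u := fun k => φε (e' k))
    (Submodule.isClosed_topologicalClosure _) (fun k => Submodule.isClosed_topologicalClosure _)
    hc hUW hHU
    (fun s hs u w C hu hC hw => mem_H10_of_weakTendsto hn hΩo hΩb hc hHW (U := fun k => U (s k))
      (fun k => hUW (s k)) (ρ := fun k => e' (s k) * r₀) (fun k => hρ0 (s k)) (fun k => hρ1 (s k))
      (hρ.comp hs.tendsto_atTop) (fun k => hUfr (s k)) hu hC hw)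
    hi (eigenLevels_H10_nonempty hΩo hΩb hsimple) hsimple hφ hφn
    (fun k => hφε _ (he'1 k)) (fun k => hφεn _ (he'1 k)) (fun k => hsign _ (he'1 k))
  exact ⟨fun k => s k + m, hs⟩
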